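/- Let $N\ge 1$ and let $\phi$ be a permutation of $\{1,\dots,2N\}$. Let $\Lambda=\Lambda_{2N}$ be a $2$-graph (a countable category with a degree functor $d:\Lambda\to\mathbb N^2$ that has the factorization property; the identity morphisms are the vertices, and the morphisms of degree $e_1$ and $e_2$ are the blue and red edges) with $2N+1$ vertices $v,Q_1,\dots,Q_{2N}$ such that, for each of the two colors and each $i$, there are exactly one edge from $v$ to $Q_i$ and exactly one edge from $Q_i$ to $v$, and there are no other edges, and such that, for each $i$, the red-blue path $(v,Q_i,v)$ equals the blue-red path $(v,Q_{\phi(i)},v)$ (vertices and edges of a path are listed starting from its range). Let $\phi$ consist of $d$ cycles (fixed points included), let $c_m$ be the smallest entry and $\ell_m$ the length of the $m$-th cycle, and let $x^1,\dots,x^d\in\mathbb R^{2N}$ be vectors with $0<x^m_i<1$ and $\sum_{i=1}^{2N}x^m_i=1$. Define the $2N\times 2N$ matrix $T_x$ by $$T_x(i,j)=x^m_{\phi^{-(n-1)}(j)}\quad\text{if } i=\phi^{n-1}(c_m),\ 1\le n\le \ell_m,$$ and assume that $T_x(\phi(i),\phi(j))=T_x(i,j)$ for all $i,j$ (equivalently,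 $x^m_{\phi^{\ell_m}(j)}=x^m_j$ for all $m,j$). Let $\Lambda^\infty$ be the space of infinite paths of $\Lambda$ (degree-preserving functors $\Omega_2\to\Lambda$), with the Borel $\sigma$-algebra of the topology generated by the cylinder sets $Z(\lambda)=\{\xi:\xi(0,d(\lambda))=\lambda\}$. Written as an alternating red-blue path that starts with a red edge, an infinite path passes through the vertices $v,Q_{a_1},v,Q_{a_2},\dots$ or $Q_{a_1},v,Q_{a_2},v,\dots$, and it is determined by this sequence of vertices, so that $\Lambda^\infty\cong\prod_{i\in\mathbb N}\mathbb Z_{2N}\sqcup\prod_{i\in\mathbb N}\mathbb Z_{2N}$. Then the following hold. 1. There is a unique Borel measure $\mu_x$ on $\Lambda^\infty$ with $$\mu_x(Z(a_1\cdots a_n))=\prod_{i=1}^{n-1}T_x(a_i,a_{i+1})$$ for all $n\ge1$ and all cylinder sets $Z(a_1\cdots a_n)$ in either copy of $\prod_{i\in\mathbb N}\mathbb Z_{2N}$. There is also a unique Borel measure $M$ on $\Lambda^\infty$ (the Perron–Frobenius measure) with $M(Z(\lambda))=\rho_1^{-d(\lambda)_1}\rho_2^{-d(\lambda)_2}\kappa_{s(\lambda)}$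 for all $\lambda\in\Lambda$, where $\rho_i$ is the spectral radius of the vertex matrix $A_i(a,b)=|a\Lambda^{e_i}b|$, and $\kappa$ is the positive vector with $\sum_a\kappa_a=1$ and $A_i\kappa=\rho_i\kappa$ for $i=1,2$. 2. The prefixing maps $\sigma_\lambda:Z(s(\lambda))\to Z(\lambda)$, $\sigma_\lambda(\xi)=\lambda\xi$, and the coding maps $\sigma^m:\Lambda^\infty\to\Lambda^\infty$, $\sigma^m(\xi)(p,q)=\xi(p+m,q+m)$, form a $\Lambda$-semibranching function system on $(\Lambda^\infty,\mu_x)$. That is, with $D_\lambda=Z(s(\lambda))$ and $R_\lambda=\sigma_\lambda(D_\lambda)$, all these maps are measurable and: (a) for each $m\in\mathbb N^2$, the sets $R_\lambda$ with $d(\lambda)=m$ cover $\Lambda^\infty$ and are pairwise disjoint up to $\mu_x$-null sets, the Radon–Nikodym derivatives $\frac{d(\mu_x\circ\sigma_\lambda)}{d\mu_x}$ exist and are positive almost everywhere on $D_\lambda$, and $\sigma^m\circ\sigma_\lambda=\mathrm{id}_{D_\lambda}$; (b) for each vertex $a$, $\sigma_a$ is the identity of $D_a$, and $\mu_x(D_a)>0$;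 (c) if $s(\lambda)=r(\nu)$, then $R_\nu\subseteq D_\lambda$ and $D_{\lambda\nu}=D_\nu$ up to null sets, and $\sigma_\lambda\sigma_\nu=\sigma_{\lambda\nu}$ almost everywhere on $D_\nu$; (d) $\sigma^m\circ\sigma^n=\sigma^{m+n}$ for all $m,n\in\mathbb N^2$. 3. If the vectors $x^m$ are not all constant, that is, if $x^m_i\ne x^m_j$ for some $m,i,j$, then $\mu_x$ and $M$ are mutually singular. -/

import Mathlib

open CategoryTheory MeasureTheory
open scoped NNReal ENNReal

universe w u

/-! ## Higher-rank graphs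

A path with range `a` and source `b` is a morphism `η : a ⟶ b`, so that the concatenation `ην` of
paths with `s(η) = r(ν)` is `η ≫ ν`. The vertices are the objects (the identity morphisms). -/

/-- A `k`-graph: a countable small category with a degree functor to `ℕ^k` that has the
factorization property. -/
class KGraph (k : ℕ) (Λ : Type u) [Category.{w} Λ] where
  countable_obj : Countable Λ
  countable_hom : ∀ a b : Λ, Countable (a ⟶ b)
  degree : ∀ {a b : Λ}, (a ⟶ b) → (Fin k → ℕ)
  degree_id : ∀ a : Λ, degree (𝟙 a) = 0
  degree_comp : ∀ {a b c : Λ} (η : a ⟶ b) (ν : b ⟶ c), degree (η ≫ ν) = degree η + degree ν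
  factorization : ∀ {a c : Λ} (η : a ⟶ c) (m n : Fin k → ℕ), degree η = m + n →
    ∃! t : Σ b : Λ, (a ⟶ b) × (b ⟶ c),
      degree t.2.1 = m ∧ degree t.2.2 = n ∧ t.2.1 ≫ t.2.2 = η

/-- The elements of `Λ`, i.e. all finite paths, each with its range `r` and its source `s`. -/
structure FinPath (Λ : Type u) [Category.{w} Λ] where
  r : Λ
  s : Λ
  hom : r ⟶ s

/-- The degree of a finite path. -/
def FinPath.deg (k : ℕ) {Λ : Type u} [Category.{w} Λ] [KGraph k Λ] (η : FinPath Λ) : Fin k → ℕ :=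
  KGraph.degree η.hom

/-- The vertex `a` regarded as a path of degree `0`. -/
def FinPath.ofVertex {Λ : Type u} [Category.{w} Λ] (a : Λ) : FinPath Λ := ⟨a, a, 𝟙 a⟩

/-! ## Infinite paths -/

/-- An infinite path: a degree-preserving functor `Ω_k → Λ`. The category `Ω_k` has the objects
`ℕ^k` and exactly one morphism `(p, q)`, of range `p`, source `q` and degree `q - p`, for `p ≤ q`.
Here `vertex p` is `x(p)` and `map` sends `(p, q)` to `x(p, q)`. -/
structure InfinitePath (k : ℕ) (Λ : Type u) [Category.{w} Λ] [KGraph k Λ] where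
  vertex : (Fin k → ℕ) → Λ
  map : ∀ {p q : Fin k → ℕ}, p ≤ q → (vertex p ⟶ vertex q)
  map_refl : ∀ p, map (le_refl p) = 𝟙 (vertex p)
  map_trans : ∀ {p q t : Fin k → ℕ} (h : p ≤ q) (h' : q ≤ t),
    map (h.trans h') = map h ≫ map h'
  degree_map : ∀ {p q : Fin k → ℕ} (h : p ≤ q), KGraph.degree (map h) = q - p

namespace InfinitePath

variable {k : ℕ} {Λ : Type u} [Category.{w} Λ] [KGraph k Λ]

/-- The finite path `x(p, q)`. -/
def seg (x : InfinitePath k Λ) (p q : Fin k → ℕ) (h : p ≤ q) : FinPath Λ :=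
  ⟨x.vertex p, x.vertex q, x.map h⟩

/-- The coding (shift) map `σ^m`, `σ^m(x)(p, q) = x(p + m, q + m)`. -/
def shift (m : Fin k → ℕ) (x : InfinitePath k Λ) : InfinitePath k Λ where
  vertex p := x.vertex (p + m)
  map h := x.map (add_le_add h le_rfl)
  map_refl p := x.map_refl (p + m)
  map_trans h h' := x.map_trans (add_le_add h le_rfl) (add_le_add h' le_rfl)
  degree_map {p q} h := by
    rw [x.degree_map]; funext i; exact Nat.add_sub_add_right _ _ _

variable (k) in
/-- The cylinder set `Z(η) = {x : x(0, d(η)) = η}`. -/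
def cylinder (η : FinPath Λ) : Set (InfinitePath k Λ) :=
  {x | x.seg 0 (η.deg k) (fun _ => Nat.zero_le _) = η}

/-- The topology generated by the cylinder sets. -/
instance : TopologicalSpace (InfinitePath k Λ) :=
  TopologicalSpace.generateFrom (Set.range (cylinder k))

/-- The Borel `σ`-algebra of the infinite path space. -/
instance : MeasurableSpace (InfinitePath k Λ) := borel _

instance : BorelSpace (InfinitePath k Λ) := ⟨rfl⟩

open Classical in
/-- The prefixing map `σ_η`: for `x` with `r(x) = s(η)`, the path `ηx` is the unique infinite path
that starts with `η` and whose shift by `d(η)` is `x` (see `existsUnique_prefix`). The value at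
other `x` is irrelevant. -/
noncomputable def pre (η : FinPath Λ) (x : InfinitePath k Λ) : InfinitePath k Λ :=
  if h : ∃ y : InfinitePath k Λ, y ∈ cylinder k η ∧ shift (η.deg k) y = x then h.choose else x

theorem left_cancel (k : ℕ) {Λ : Type u} [Category.{w} Λ] [KGraph k Λ]
    {a b c : Λ} (η : a ⟶ b) (ν ν' : b ⟶ c) (h : η ≫ ν = η ≫ ν') : ν = ν' := by
  have hd : KGraph.degree (k := k) ν = KGraph.degree ν' := by
    have := congrArg (KGraph.degree (k := k)) h
    rw [KGraph.degree_comp, KGraph.degree_comp] at this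
    exact add_left_cancel this
  have := (KGraph.factorization (k := k) (η ≫ ν) (KGraph.degree η) (KGraph.degree ν)
    (KGraph.degree_comp _ _)).unique (y₁ := ⟨b, η, ν⟩) (y₂ := ⟨b, η, ν'⟩)
    ⟨rfl, rfl, rfl⟩ ⟨rfl, hd.symm, h.symm⟩
  simpa using this

theorem head_eq (k : ℕ) {Λ : Type u} [Category.{w} Λ] [KGraph k Λ]
    {a b b' c : Λ} (η : a ⟶ b) (ν : b ⟶ c) (η' : a ⟶ b') (ν' : b' ⟶ c)
    (h : η ≫ ν = η' ≫ ν') (hd : KGraph.degree (k := k) η = KGraph.degree η') :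
    (⟨a, b, η⟩ : FinPath Λ) = ⟨a, b', η'⟩ := by
  have hd2 : KGraph.degree (k := k) ν = KGraph.degree ν' := by
    have := congrArg (KGraph.degree (k := k)) h
    rw [KGraph.degree_comp, KGraph.degree_comp, hd] at this
    exact add_left_cancel this
  have := (KGraph.factorization (k := k) (η ≫ ν) (KGraph.degree η) (KGraph.degree ν)
    (KGraph.degree_comp _ _)).unique (y₁ := ⟨b, η, ν⟩) (y₂ := ⟨b', η', ν'⟩)
    ⟨rfl, rfl, rfl⟩ ⟨hd.symm, hd2.symm, h.symm⟩
  cases this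
  rfl

theorem tail_eq (k : ℕ) {Λ : Type u} [Category.{w} Λ] [KGraph k Λ]
    {a b b' c c' : Λ} {η : a ⟶ b} {ν : b ⟶ c} {η' : a ⟶ b'} {ν' : b' ⟶ c'}
    (h1 : (⟨a, b, η⟩ : FinPath Λ) = ⟨a, b', η'⟩)
    (h : (⟨a, c, η ≫ ν⟩ : FinPath Λ) = ⟨a, c', η' ≫ ν'⟩) :
    (⟨b, c, ν⟩ : FinPath Λ) = ⟨b', c', ν'⟩ := by
  obtain rfl : c = c' := congrArg FinPath.s h
  cases h1
  have h2 : η ≫ ν = η ≫ ν' := by simpa using h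
  rw [left_cancel k η ν ν' h2]

theorem comp_eq {Λ : Type u} [Category.{w} Λ] {a b b' c c' : Λ}
    {η : a ⟶ b} {ν : b ⟶ c} {η' : a ⟶ b'} {ν' : b' ⟶ c'}
    (h1 : (⟨a, b, η⟩ : FinPath Λ) = ⟨a, b', η'⟩)
    (h2 : (⟨b, c, ν⟩ : FinPath Λ) = ⟨b', c', ν'⟩) :
    (⟨a, c, η ≫ ν⟩ : FinPath Λ) = ⟨a, c', η' ≫ ν'⟩ := by
  cases h1
  cases h2
  rfl

theorem ext_seg {x y : InfinitePath k Λ} (h : ∀ p q hpq, x.seg p q hpq = y.seg p q hpq) :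
    x = y := by
  obtain ⟨vx, mx, _, _, _⟩ := x
  obtain ⟨vy, my, _, _, _⟩ := y
  obtain rfl : vx = vy := funext fun p => congrArg FinPath.r (h p p le_rfl)
  have : @mx = @my := by
    funext p q hpq
    simpa [seg] using h p q hpq
  subst this
  rfl

/-- Every finite path `η` and infinite path `x` with `r(x) = s(η)` have a unique concatenation
`ηx`. -/
theorem existsUnique_prefix (η : FinPath Λ) (x : InfinitePath k Λ) (hx : x.vertex 0 = η.s) :
    ∃! y : InfinitePath k Λ, y ∈ cylinder k η ∧ shift (η.deg k) y = x := by
  obtain ⟨a, b, η⟩ := η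
  obtain rfl : x.vertex 0 = b := hx
  let m : Fin k → ℕ := KGraph.degree η
  have h0 : ∀ n : Fin k → ℕ, 0 ≤ n := fun n _ => Nat.zero_le _
  let z : ∀ n : Fin k → ℕ, a ⟶ x.vertex n := fun n => η ≫ x.map (h0 n)
  have hz : ∀ n, KGraph.degree (k := k) (z n) = m + n := fun n => by
    simp only [z, KGraph.degree_comp, x.degree_map]
    simp [m]
  have hzz : ∀ {n n'} (h : n ≤ n'), z n ≫ x.map h = z n' := fun {n n'} h => by
    simp only [z, Category.assoc, ← x.map_trans]
  have hfac : ∀ p : Fin k → ℕ, ∃ c : Λ, ∃ f : a ⟶ c, ∃ g : c ⟶ x.vertex p,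
      KGraph.degree (k := k) f = p ∧ f ≫ g = z p := fun p => by
    obtain ⟨⟨c, f, g⟩, ⟨hf, _, hfg⟩, _⟩ := KGraph.factorization (z p) p m
      ((hz p).trans (add_comm _ _))
    exact ⟨c, f, g, hf, hfg⟩
  choose c f g hf hfg using hfac
  have hhead : ∀ {p q} (_ : p ≤ q) {d : Λ} (φ : a ⟶ d) (γ : d ⟶ x.vertex q),
      KGraph.degree (k := k) φ = p → φ ≫ γ = z q →
        (⟨a, c p, f p⟩ : FinPath Λ) = ⟨a, d, φ⟩ := fun {p q} h d φ γ hφ hγ => by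
    refine head_eq k (f p) (g p ≫ x.map h) φ γ ?_ ((hf p).trans hφ.symm)
    rw [← Category.assoc, hfg, hzz, hγ]
  have hstep : ∀ {p q} (_ : p ≤ q), ∃ e : c p ⟶ c q, f p ≫ e = f q := fun {p q} h => by
    obtain ⟨⟨d, φ, γ⟩, ⟨h1, _, h3⟩, _⟩ := KGraph.factorization (f q) p (q - p)
      (by rw [hf, add_tsub_cancel_of_le h])
    have := hhead h φ (γ ≫ g q) h1 (by rw [← Category.assoc, h3, hfg])
    simp only [] at h3
    cases this
    exact ⟨γ, h3⟩
  choose e he using @hstep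
  let y : InfinitePath k Λ :=
    { vertex := c
      map := fun h => e h
      map_refl := fun p => left_cancel k (f p) _ _ (by rw [he, Category.comp_id])
      map_trans := fun {p q t} h h' => left_cancel k (f p) _ _ (by
        rw [he, ← Category.assoc, he, he])
      degree_map := fun {p q} h => by
        have := congrArg (KGraph.degree (k := k)) (he h)
        rw [KGraph.degree_comp, hf, hf] at this
        exact eq_tsub_of_add_eq ((add_comm _ _).trans this) }
  have hfz : ∀ p, (⟨a, c (p + m), f (p + m)⟩ : FinPath Λ) = ⟨a, x.vertex p, z p⟩ := fun p =>
    hhead le_rfl (z p) (x.map (by intro i; simp)) (by rw [hz, add_comm]) (hzz _)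
  have hf0 : (⟨a, c 0, f 0⟩ : FinPath Λ) = ⟨a, a, 𝟙 a⟩ :=
    hhead le_rfl (𝟙 a) (z 0) (KGraph.degree_id _) (Category.id_comp _)
  have hfm : (⟨a, c m, f m⟩ : FinPath Λ) = ⟨a, x.vertex 0, η⟩ :=
    hhead le_rfl η (x.map (h0 m)) rfl rfl
  refine ⟨y, ⟨?_, ?_⟩, ?_⟩
  · change (⟨c 0, c m, e (h0 m)⟩ : FinPath Λ) = ⟨a, x.vertex 0, η⟩
    refine tail_eq k hf0 ?_
    rw [he, Category.id_comp, hfm]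
  · refine ext_seg fun p q h => ?_
    change (⟨c (p + m), c (q + m), e (add_le_add h le_rfl : p + m ≤ q + m)⟩ : FinPath Λ)
      = ⟨x.vertex p, x.vertex q, x.map h⟩
    refine tail_eq k (hfz p) ?_
    rw [he, hzz, hfz]
  · rintro y' ⟨hy1, hy2⟩
    have hy0 : y'.vertex 0 = a := congrArg FinPath.r hy1
    subst hy0
    have hsz : ∀ p, (⟨y'.vertex 0, y'.vertex (p + m), y'.map (h0 _)⟩ : FinPath Λ) =
        ⟨y'.vertex 0, x.vertex p, z p⟩ := fun p => by
      have hle : 0 + m ≤ p + m := add_le_add (h0 p) le_rfl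
      have h1 : (⟨y'.vertex (0 + m), y'.vertex (p + m), y'.map hle⟩ : FinPath Λ) =
          ⟨x.vertex 0, x.vertex p, x.map (h0 p)⟩ :=
        congrArg (fun t : InfinitePath k Λ => t.seg 0 p (h0 p)) hy2
      have h2 : ∀ {n n'} (_ : n = n'), y'.seg 0 n (h0 n) = y'.seg 0 n' (h0 n') := by
        rintro n _ rfl; rfl
      rw [y'.map_trans (h0 (0 + m)) hle]
      exact comp_eq ((h2 (zero_add m)).trans hy1) h1
    have hs : ∀ p, (⟨y'.vertex 0, c p, f p⟩ : FinPath Λ) =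
        ⟨y'.vertex 0, y'.vertex p, y'.map (h0 p)⟩ := fun p => by
      have h1 := hsz p
      have hle : p ≤ p + m := by intro i; simp
      have h2 := y'.map_trans (h0 p) hle
      have h3 := y'.degree_map (h0 p)
      revert h1 h2
      generalize y'.map ((h0 p).trans hle) = t
      generalize y'.map hle = t2
      generalize y'.vertex (p + m) = V at *
      intro h1 h2
      cases h1
      exact hhead le_rfl (y'.map (h0 p)) t2 (by rw [h3]; simp) h2.symm
    refine (ext_seg fun p q h => ?_).symm
    change (⟨c p, c q, e h⟩ : FinPath Λ) = ⟨y'.vertex p, y'.vertex q, y'.map h⟩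
    refine tail_eq k (hs p) ?_
    rw [he, hs q, ← y'.map_trans]

end InfinitePath

/-! ## Semibranching function systems

A map `τ : D → X` with `D ⊆ X` is given as a map on `X` of which only the restriction to `D`
matters. -/

/-- The family `τ i : D i → X` of measurable maps is a semibranching function system on `(X, μ)`.
The last clause says that `E ↦ μ (τ i (E))` is, on the measurable subsets of `D i`, a measure with
a Radon–Nikodym derivative `Φ` with respect to `μ`, and that `Φ > 0` almost everywhere on `D i`. -/
structure IsSemibranching {X : Type*} [MeasurableSpace X] (μ : Measure X) {ι : Type*}
    (D : ι → Set X) (τ : ι → X → X) : Prop where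
  measurableSet_domain : ∀ i, MeasurableSet (D i)
  measurable_map : ∀ i, Measurable (fun x : D i => τ i x)
  cover : μ (⋃ i, τ i '' D i)ᶜ = 0
  disjoint : ∀ i j, i ≠ j → μ (τ i '' D i ∩ τ j '' D j) = 0
  derivative : ∀ i, ∃ Φ : X → ℝ≥0, Measurable Φ ∧
    (∀ E ⊆ D i, MeasurableSet E →
      MeasurableSet (τ i '' E) ∧ μ (τ i '' E) = ∫⁻ x in E, (Φ x : ℝ≥0∞) ∂μ) ∧
    ∀ᵐ x ∂μ.restrict (D i), 0 < Φ x

/-- `σ` is a coding map for the family `τ i : D i → X`. -/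
structure IsCodingMap {X : Type*} [MeasurableSpace X] {ι : Type*}
    (D : ι → Set X) (τ : ι → X → X) (σ : X → X) : Prop where
  measurable : Measurable σ
  left_inverse : ∀ i, ∀ x ∈ D i, σ (τ i x) = x

/-- A `Λ`-semibranching function system on `(X, μ)` with domains `D η`, prefixing maps
`τ η : D η → X` and coding maps `σ m`. -/
structure IsLambdaSemibranching (k : ℕ) {Λ : Type u} [Category.{w} Λ] [KGraph k Λ]
    {X : Type*} [MeasurableSpace X] (μ : Measure X)
    (D : FinPath Λ → Set X) (τ : FinPath Λ → X → X) (σ : (Fin k → ℕ) → X → X) : Prop where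
  semibranching : ∀ m : Fin k → ℕ,
    IsSemibranching μ (fun η : {η : FinPath Λ // η.deg k = m} => D η) (fun η => τ η)
  coding : ∀ m : Fin k → ℕ,
    IsCodingMap (fun η : {η : FinPath Λ // η.deg k = m} => D η) (fun η => τ η) (σ m)
  vertex_map : ∀ a : Λ, ∀ x ∈ D (FinPath.ofVertex a), τ (FinPath.ofVertex a) x = x
  vertex_pos : ∀ a : Λ, 0 < μ (D (FinPath.ofVertex a))
  range_subset : ∀ {a b c : Λ} (η : a ⟶ b) (ν : b ⟶ c),
    μ (τ ⟨b, c, ν⟩ '' D ⟨b, c, ν⟩ \ D ⟨a, b, η⟩) = 0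
  domain_comp : ∀ {a b c : Λ} (η : a ⟶ b) (ν : b ⟶ c), D ⟨a, c, η ≫ ν⟩ =ᵐ[μ] D ⟨b, c, ν⟩
  map_comp : ∀ {a b c : Λ} (η : a ⟶ b) (ν : b ⟶ c),
    ∀ᵐ x ∂μ.restrict (D ⟨b, c, ν⟩), τ ⟨a, b, η⟩ (τ ⟨b, c, ν⟩ x) = τ ⟨a, c, η ≫ ν⟩ x
  coding_comp : ∀ m n : Fin k → ℕ, σ m ∘ σ n = σ (m + n)

/-- The standard prefixing maps `σ_η : Z(s(η)) → Z(η)`, `x ↦ ηx`, and the standard coding maps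
`σ^m` on `Λ^∞` form a `Λ`-semibranching function system for the measure `μ`. -/
def StandardMapsSemibranching (k : ℕ) {Λ : Type u} [Category.{w} Λ] [KGraph k Λ]
    (μ : Measure (InfinitePath k Λ)) : Prop :=
  IsLambdaSemibranching k μ
    (fun η : FinPath Λ => InfinitePath.cylinder k (FinPath.ofVertex η.s))
    InfinitePath.pre InfinitePath.shift

/-! ## The Perron–Frobenius measure -/

/-- The `i`-th vertex matrix, `A_i(a, b) = |aΛ^{e_i}b|`. -/
noncomputable def vertexMatrix (k : ℕ) (Λ : Type u) [Category.{w} Λ] [KGraph k Λ] (i : Fin k) :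
    Matrix Λ Λ ℕ :=
  Matrix.of fun a b => Nat.card {f : a ⟶ b // KGraph.degree f = (Pi.single i 1 : Fin k → ℕ)}

/-- The spectral radius `ρ_i` of the `i`-th vertex matrix. -/
noncomputable def vertexRadius (k : ℕ) (Λ : Type u) [Category.{w} Λ] [KGraph k Λ]
    [Fintype Λ] [DecidableEq Λ] (i : Fin k) : ℝ :=
  (spectralRadius ℂ ((vertexMatrix k Λ i).map (fun n : ℕ => (n : ℂ)))).toReal

/-- `κ` is the unimodular Perron–Frobenius eigenvector of `Λ`. -/
structure IsPerronFrobeniusVector (k : ℕ) {Λ : Type u} [Category.{w} Λ] [KGraph k Λ]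
    [Fintype Λ] [DecidableEq Λ] (κ : Λ → ℝ) : Prop where
  pos : ∀ a, 0 < κ a
  sum_eq_one : ∑ a, κ a = 1
  eigen : ∀ i : Fin k,
    ((vertexMatrix k Λ i).map (fun n : ℕ => (n : ℝ))).mulVec κ = vertexRadius k Λ i • κ

/-- `M` is the Perron–Frobenius measure: `M(Z(η)) = ρ(Λ)^{-d(η)} κ_{s(η)}` for all `η`, with `κ` the
unimodular Perron–Frobenius eigenvector. -/
def IsPerronFrobeniusMeasure (k : ℕ) {Λ : Type u} [Category.{w} Λ] [KGraph k Λ]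
    [Fintype Λ] [DecidableEq Λ] (M : Measure (InfinitePath k Λ)) : Prop :=
  ∃ κ : Λ → ℝ, IsPerronFrobeniusVector k κ ∧ ∀ η : FinPath Λ,
    M (InfinitePath.cylinder k η) =
      ENNReal.ofReal ((∏ i, vertexRadius k Λ i ^ η.deg k i)⁻¹ * κ η.s)

/-! ## The `2`-graphs `Λ_{2N}` -/

/-- The degree of the blue edges. -/
def blue : Fin 2 → ℕ := Pi.single 0 1

/-- The degree of the red edges. -/
def red : Fin 2 → ℕ := Pi.single 1 1

/-- `Λ` is a `2`-graph `Λ_{2N}` with the factorization rule determined by the permutation `φ`. Its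
vertices are the center `v` and the `2N` distinct outer vertices `Q i`. For each of the two colors
there are exactly one edge from `v` to `Q i` and one from `Q i` to `v`, for each `i`, and no other
edges. The red-blue path `(v, Q i, v)` equals the blue-red path `(v, Q (φ i), v)`. -/
structure IsLambda2N {N : ℕ} (φ : Equiv.Perm (Fin (2 * N))) {Λ : Type u} [Category.{w} Λ]
    [KGraph 2 Λ] (v : Λ) (Q : Fin (2 * N) → Λ) : Prop where
  outer_injective : Function.Injective Q
  outer_ne_center : ∀ i, Q i ≠ v
  vertex_cases : ∀ a : Λ, a = v ∨ ∃ i, a = Q i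
  edge_center_outer : ∀ c ∈ ({blue, red} : Set (Fin 2 → ℕ)), ∀ i,
    ∃! f : v ⟶ Q i, KGraph.degree f = c
  edge_outer_center : ∀ c ∈ ({blue, red} : Set (Fin 2 → ℕ)), ∀ i,
    ∃! f : Q i ⟶ v, KGraph.degree f = c
  no_edge_center_center : ∀ c ∈ ({blue, red} : Set (Fin 2 → ℕ)),
    ∀ f : v ⟶ v, KGraph.degree f ≠ c
  no_edge_outer_outer : ∀ c ∈ ({blue, red} : Set (Fin 2 → ℕ)), ∀ i j,
    ∀ f : Q i ⟶ Q j, KGraph.degree f ≠ c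
  factorization_rule : ∀ i (f : v ⟶ Q i) (g : Q i ⟶ v) (f' : v ⟶ Q (φ i)) (g' : Q (φ i) ⟶ v),
    KGraph.degree f = red → KGraph.degree g = blue →
    KGraph.degree f' = blue → KGraph.degree g' = red → f ≫ g = f' ≫ g'

/-! ## The matrices `T_x` and the Markov measures -/

/-- The cycles of `φ` (fixed points included), each represented by its smallest entry. -/
def CycleMin {n : ℕ} (φ : Equiv.Perm (Fin n)) : Type :=
  {c : Fin n // ∀ j, φ.SameCycle c j → c ≤ j}

theorem exists_cycleMin {n : ℕ} (φ : Equiv.Perm (Fin n)) (i : Fin n) :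
    ∃ c : CycleMin φ, ∃ t : ℕ, (φ ^ t) c.1 = i := by
  classical
  obtain ⟨c, hc, hmin⟩ := Finset.exists_min_image
    (Finset.univ.filter fun j => φ.SameCycle i j) id ⟨i, by simp [Equiv.Perm.SameCycle.refl]⟩
  simp only [Finset.mem_filter, Finset.mem_univ, true_and, id] at hc hmin
  obtain ⟨t, _, ht⟩ := hc.symm.exists_pow_eq'
  exact ⟨⟨c, fun j hj => hmin j (hc.trans hj)⟩, t, ht⟩

open Classical in
/-- The matrix `T_x` of a family `x` of vectors, one for each cycle of `φ`: if `i = φ^t(c)`, where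
`c` is the smallest entry of the cycle of `i` and `t` is the least such exponent, then
`T_x(i, j) = x^c_{φ^{-t}(j)}`. -/
noncomputable def cycleMatrix {n : ℕ} (φ : Equiv.Perm (Fin n)) (x : CycleMin φ → Fin n → ℝ) :
    Matrix (Fin n) (Fin n) ℝ :=
  Matrix.of fun i j =>
    x (exists_cycleMin φ i).choose ((φ ^ Nat.find (exists_cycleMin φ i).choose_spec)⁻¹ j)

/-- The cylinder `Z(a_0 ⋯ a_n)` in the first copy of `∏ ℤ_{2N}` in `Λ_{2N}^∞`. The path `ξ` with
range `v` corresponds to the sequence `(a_t)` for which `ξ`, written as a path whose edges are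
alternately red and blue with a red edge first, passes through `v, Q (a 0), v, Q (a 1), v, …`. -/
def centerCylinder {N : ℕ} {Λ : Type u} [Category.{w} Λ] [KGraph 2 Λ] (v : Λ)
    (Q : Fin (2 * N) → Λ) {n : ℕ} (a : Fin (n + 1) → Fin (2 * N)) : Set (InfinitePath 2 Λ) :=
  {ξ | ξ.vertex 0 = v ∧ ∀ t : Fin (n + 1), ξ.vertex ((t : ℕ) • (red + blue) + red) = Q (a t)}

/-- The cylinder `Z(a_0 ⋯ a_n)` in the second copy of `∏ ℤ_{2N}` in `Λ_{2N}^∞`. The path `ξ` with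
range other than `v` corresponds to the sequence `(a_t)` for which `ξ`, written as before, passes
through `Q (a 0), v, Q (a 1), v, …`. -/
def outerCylinder {N : ℕ} {Λ : Type u} [Category.{w} Λ] [KGraph 2 Λ]
    (Q : Fin (2 * N) → Λ) {n : ℕ} (a : Fin (n + 1) → Fin (2 * N)) : Set (InfinitePath 2 Λ) :=
  {ξ | ∀ t : Fin (n + 1), ξ.vertex ((t : ℕ) • (red + blue)) = Q (a t)}

/-- `μ` is the measure on `Λ_{2N}^∞` given on the cylinder sets of either copy of `∏ ℤ_{2N}` by
`μ(Z(a_0 ⋯ a_n)) = ∏_{t < n} T(a_t, a_{t+1})`. -/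
structure IsMarkovMeasure {N : ℕ} {Λ : Type u} [Category.{w} Λ] [KGraph 2 Λ] (v : Λ)
    (Q : Fin (2 * N) → Λ) (T : Matrix (Fin (2 * N)) (Fin (2 * N)) ℝ)
    (μ : Measure (InfinitePath 2 Λ)) : Prop where
  center : ∀ (n : ℕ) (a : Fin (n + 1) → Fin (2 * N)),
    μ (centerCylinder v Q a) = ENNReal.ofReal (∏ t : Fin n, T (a t.castSucc) (a t.succ))
  outer : ∀ (n : ℕ) (a : Fin (n + 1) → Fin (2 * N)),
    μ (outerCylinder Q a) = ENNReal.ofReal (∏ t : Fin n, T (a t.castSucc) (a t.succ))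

/-! Between the center and each outer vertex there is one edge of each color in each direction. An
infinite path is therefore determined by the vertices on its alternating red-blue path, and every
second one of these is the center. What remains is a sequence of letters in `Fin (2 * N)` together
with the kind of vertex at which the path starts. The cylinders of these codings are cylinders of
finite paths; they form a countable π-system that generates the Borel σ-algebra, so they determine a
measure (`IsLambda2N.measure_ext`). This gives both uniqueness statements. Existence is that of a
Markov chain started with mass one in every state (`exists_markov_sequence_measure`).

In terms of codings, the factorization rule says that a path at the center sees `Q i` along red
exactly when it sees `Q (φ i)` along blue. Prefixing an edge from the center turns an outer coding
`(a_t)` into the center coding `(ψ⁻¹ a_t)`, and prefixing an edge from `Q i` turns a center coding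
`(a_t)` into `(i, ψ a_0, ψ a_1, …)`, where `ψ` is `1` or `φ`. Since `T_x` is invariant under `φ`,
the first operation preserves `μ_x`, and the second has the density `T_x(i, ψ j) > 0` on the paths
with first letter `j` (`measure_prefix_center`, `measure_prefix_outer`). By induction over edges all
prefixing maps respect null sets in both directions. By the Radon–Nikodym theorem this, with
positive mass on every vertex, is all that a semibranching system asks for beyond the algebra of
concatenation (`standardMapsSemibranching_of_quasiInvariant`).

Both vertex matrices are the adjacency matrix of a star with `2N` leaves, of spectral radius
`√(2N)`. Up to a weight on each copy of the sequence space, the Perron–Frobenius measure `M` is the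
Markov measure of the matrix with all entries `1/(2N)`.

Singularity is a Hellinger affinity argument (`mutuallySingular_of_affinity`). A measure `ξ` below
both `μ_x` and `M` is on each cylinder at most the minimum, hence at most the geometric mean, of
their values. Up to a constant this mean is a path product of `S(i, j) = √(T_x(i, j) / (2N))`, so
summing over words bounds the mass of `ξ` by a multiple of the sum of the entries of `S^(2k)`. The
rows of `S` have sum at most one by AM-GM, and less than one where the row of `T_x` is not uniform;
as `S` is positive, all row sums of `S^2` are then at most some `θ < 1`. The mass of `ξ` is
`O(θ^k)`, thus zero. A nonconstant `x^c` provides a non-uniform row, because row `c` of `T_x` is a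
rearrangement of `x^c`. -/

/-! ## Paths in `k`-graphs -/

namespace FinPath

variable {Λ : Type u} [Category.{w} Λ]

theorem eq_iff_of_endpoints {a b : Λ} {η ν : a ⟶ b} :
    (⟨a, b, η⟩ : FinPath Λ) = ⟨a, b, ν⟩ ↔ η = ν := by
  simp

theorem comp_congr {a b c a' b' c' : Λ} {η : a ⟶ b} {ν : b ⟶ c} {η' : a' ⟶ b'} {ν' : b' ⟶ c'}
    (h1 : (⟨a, b, η⟩ : FinPath Λ) = ⟨a', b', η'⟩) (h2 : (⟨b, c, ν⟩ : FinPath Λ) = ⟨b', c', ν'⟩) :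
    (⟨a, c, η ≫ ν⟩ : FinPath Λ) = ⟨a', c', η' ≫ ν'⟩ := by
  cases h1
  cases h2
  rfl

/-- Equality in `FinPath` compares paths whose endpoints are only propositionally equal; the content
is unique factorization. -/
theorem head_congr (k : ℕ) [KGraph k Λ] {a b c a' b' c' : Λ} {η : a ⟶ b} {ν : b ⟶ c}
    {η' : a' ⟶ b'} {ν' : b' ⟶ c'}
    (h : (⟨a, c, η ≫ ν⟩ : FinPath Λ) = ⟨a', c', η' ≫ ν'⟩)
    (hd : KGraph.degree (k := k) η = KGraph.degree η') :
    (⟨a, b, η⟩ : FinPath Λ) = ⟨a', b', η'⟩ := by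
  obtain rfl : a = a' := congrArg FinPath.r h
  obtain rfl : c = c' := congrArg FinPath.s h
  exact InfinitePath.head_eq k η ν η' ν' (eq_iff_of_endpoints.1 h) hd

theorem tail_congr (k : ℕ) [KGraph k Λ] {a b c a' b' c' : Λ} {η : a ⟶ b} {ν : b ⟶ c}
    {η' : a' ⟶ b'} {ν' : b' ⟶ c'}
    (h1 : (⟨a, b, η⟩ : FinPath Λ) = ⟨a', b', η'⟩)
    (h : (⟨a, c, η ≫ ν⟩ : FinPath Λ) = ⟨a', c', η' ≫ ν'⟩) :
    (⟨b, c, ν⟩ : FinPath Λ) = ⟨b', c', ν'⟩ := by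
  obtain rfl : a = a' := congrArg FinPath.r h
  exact InfinitePath.tail_eq k h1 h

theorem countable (k : ℕ) [KGraph k Λ] : Countable (FinPath Λ) := by
  have := KGraph.countable_obj (k := k) (Λ := Λ)
  have := KGraph.countable_hom (k := k) (Λ := Λ)
  have : Function.Injective (fun η : FinPath Λ => (⟨η.r, η.s, η.hom⟩ : Σ a b : Λ, (a ⟶ b))) := by
    rintro ⟨a, b, η⟩ ⟨a', b', η'⟩ h
    cases h
    rfl
  exact this.countable

/-- Every finite path is a concatenation of edges. -/
theorem edge_induction (k : ℕ) [KGraph k Λ] {P : FinPath Λ → Prop}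
    (vertex : ∀ a, P (ofVertex a))
    (edge : ∀ {a b c : Λ} (e : a ⟶ b) (ν : b ⟶ c) (i : Fin k),
      KGraph.degree e = (Pi.single i 1 : Fin k → ℕ) → P ⟨b, c, ν⟩ → P ⟨a, c, e ≫ ν⟩)
    (η : FinPath Λ) : P η := by
  obtain ⟨n, hn⟩ : ∃ n, ∑ i, η.deg k i = n := ⟨_, rfl⟩
  induction n generalizing η with
  | zero =>
    obtain ⟨a, b, η⟩ := η
    have h0 : KGraph.degree (k := k) η = 0 := by
      funext i
      exact Finset.sum_eq_zero_iff.1 hn i (Finset.mem_univ i)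
    -- Both `𝟙 ≫ η` and `η ≫ 𝟙` factor `η` in degrees `0` and `0`, so uniqueness forces `η` to be an
    -- identity.
    have h := (KGraph.factorization (k := k) η 0 0 (by rw [h0]; rfl)).unique
      (y₁ := ⟨a, 𝟙 a, η⟩) (y₂ := ⟨b, η, 𝟙 b⟩)
      ⟨KGraph.degree_id _, h0, Category.id_comp _⟩ ⟨h0, KGraph.degree_id _, Category.comp_id _⟩
    cases h
    exact vertex _
  | succ n ih =>
    obtain ⟨a, c, η⟩ := η
    obtain ⟨i, hi⟩ : ∃ i, KGraph.degree (k := k) η i ≠ 0 := by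
      by_contra! h
      have : ∑ i, FinPath.deg k ⟨a, c, η⟩ i = 0 := Finset.sum_eq_zero fun i _ => h i
      omega
    have hle : (Pi.single i 1 : Fin k → ℕ) ≤ KGraph.degree η := by
      intro j
      rcases eq_or_ne j i with rfl | hj
      · simpa using Nat.one_le_iff_ne_zero.2 hi
      · simp [hj]
    obtain ⟨⟨b, e, ν⟩, ⟨h1, h2, h3⟩, -⟩ := KGraph.factorization (k := k) η (Pi.single i 1)
      (KGraph.degree η - Pi.single i 1) (by rw [add_tsub_cancel_of_le hle])
    simp only at h1 h2 h3
    subst h3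
    refine edge e ν i h1 (ih ⟨b, c, ν⟩ ?_)
    have : ∑ j, (Pi.single i 1 + KGraph.degree (k := k) ν : Fin k → ℕ) j = n + 1 := by
      rw [← h1, ← KGraph.degree_comp]; exact hn
    simp only [Pi.add_apply, Finset.sum_add_distrib, Finset.sum_pi_single', Finset.mem_univ,
      if_true] at this
    change ∑ j, KGraph.degree (k := k) ν j = n
    omega

end FinPath

/-! ### Segments, cylinders, shifts and prefixing of infinite paths -/

namespace InfinitePath

variable {k : ℕ} {Λ : Type u} [Category.{w} Λ] [KGraph k Λ]

theorem seg_congr (x : InfinitePath k Λ) {p q p' q' : Fin k → ℕ} (hp : p = p') (hq : q = q')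
    (h : p ≤ q) : x.seg p q h = x.seg p' q' (hp ▸ hq ▸ h) := by
  subst hp hq
  rfl

theorem deg_seg (x : InfinitePath k Λ) {p q : Fin k → ℕ} (h : p ≤ q) :
    (x.seg p q h).deg k = q - p := x.degree_map h

/-- Unique factorization cuts off the tail, then cancellation removes the head. -/
theorem seg_subpath {x y : InfinitePath k Λ} {p q q' t : Fin k → ℕ} {hq : p ≤ t} {hq' : p ≤ t}
    (h : x.seg p t hq = y.seg p t hq') (hp' : p ≤ q) (hqq : q ≤ q') (hq't : q' ≤ t) :
    x.seg q q' hqq = y.seg q q' hqq := by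
  have h1 : x.seg p q' (hp'.trans hqq) = y.seg p q' (hp'.trans hqq) := by
    refine FinPath.head_congr k (ν := x.map hq't) (ν' := y.map hq't) ?_
      (by rw [x.degree_map, y.degree_map])
    rw [← x.map_trans, ← y.map_trans]
    exact h
  have h2 : (⟨_, _, x.map hp' ≫ x.map hqq⟩ : FinPath Λ) = ⟨_, _, y.map hp' ≫ y.map hqq⟩ := by
    rw [← x.map_trans, ← y.map_trans]
    exact h1
  exact FinPath.tail_congr k
    (FinPath.head_congr k h2 (by rw [x.degree_map, y.degree_map])) h2

theorem vertex_eq_of_seg_eq {x y : InfinitePath k Λ} {p q t : Fin k → ℕ} {h₁ h₂ : p ≤ t}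
    (h : x.seg p t h₁ = y.seg p t h₂) (hp : p ≤ q) (hq : q ≤ t) : x.vertex q = y.vertex q :=
  congrArg FinPath.r (seg_subpath h hp le_rfl hq)

theorem seg_trans_congr {x y : InfinitePath k Λ} {p q t : Fin k → ℕ} (h₁ : p ≤ q) (h₂ : q ≤ t)
    (h : x.seg p q h₁ = y.seg p q h₁) (h' : x.seg q t h₂ = y.seg q t h₂) :
    x.seg p t (h₁.trans h₂) = y.seg p t (h₁.trans h₂) := by
  have := FinPath.comp_congr h h'
  rwa [← x.map_trans, ← y.map_trans] at this

theorem seg_shift (x : InfinitePath k Λ) (m : Fin k → ℕ) {p q : Fin k → ℕ} (h : p ≤ q) :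
    (x.shift m).seg p q h = x.seg (p + m) (q + m) (add_le_add h le_rfl) := rfl

theorem shift_shift (m n : Fin k → ℕ) (x : InfinitePath k Λ) :
    shift m (shift n x) = shift (m + n) x :=
  ext_seg fun p q h => by
    rw [seg_shift, seg_shift, seg_shift]
    exact seg_congr x (add_assoc _ _ _) (add_assoc _ _ _) _

theorem shift_zero (x : InfinitePath k Λ) : shift 0 x = x :=
  ext_seg fun _ _ _ => rfl

theorem mem_cylinder_iff {η : FinPath Λ} {x : InfinitePath k Λ} :
    x ∈ cylinder k η ↔ x.seg 0 (η.deg k) (fun _ => Nat.zero_le _) = η := Iff.rfl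

theorem mem_cylinder_seg {x y : InfinitePath k Λ} {m : Fin k → ℕ} {h : 0 ≤ m} :
    y ∈ cylinder k (x.seg 0 m h) ↔ y.seg 0 m h = x.seg 0 m h := by
  rw [mem_cylinder_iff, seg_congr y rfl (show (x.seg 0 m h).deg k = m by
    rw [deg_seg, tsub_zero])]

theorem mem_cylinder_iff_of_deg {η : FinPath Λ} {x : InfinitePath k Λ} {m : Fin k → ℕ}
    (hm : η.deg k = m) : x ∈ cylinder k η ↔ x.seg 0 m (fun _ => Nat.zero_le _) = η := by
  subst hm
  rfl

theorem vertex_zero_of_mem {η : FinPath Λ} {x : InfinitePath k Λ} (h : x ∈ cylinder k η) :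
    x.vertex 0 = η.r := congrArg FinPath.r h

theorem vertex_deg_of_mem {η : FinPath Λ} {x : InfinitePath k Λ} (h : x ∈ cylinder k η) :
    x.vertex (η.deg k) = η.s := congrArg FinPath.s h

theorem deg_ofVertex (a : Λ) : (FinPath.ofVertex a).deg k = 0 := KGraph.degree_id a

theorem mem_cylinder_ofVertex {a : Λ} {x : InfinitePath k Λ} :
    x ∈ cylinder k (FinPath.ofVertex a) ↔ x.vertex 0 = a := by
  refine ⟨fun h => vertex_zero_of_mem h, ?_⟩
  rintro rfl
  rw [mem_cylinder_iff_of_deg (deg_ofVertex _)]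
  exact FinPath.eq_iff_of_endpoints.2 (x.map_refl 0)

theorem pre_spec {η : FinPath Λ} {x : InfinitePath k Λ}
    (hx : x ∈ cylinder k (FinPath.ofVertex η.s)) :
    pre η x ∈ cylinder k η ∧ shift (η.deg k) (pre η x) = x := by
  have h := (existsUnique_prefix η x (mem_cylinder_ofVertex.1 hx)).exists
  rw [pre, dif_pos h]
  exact h.choose_spec

theorem shift_mem {η : FinPath Λ} {x : InfinitePath k Λ} (hx : x ∈ cylinder k η) :
    shift (η.deg k) x ∈ cylinder k (FinPath.ofVertex η.s) := by
  rw [mem_cylinder_ofVertex, ← vertex_deg_of_mem hx]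
  exact congrArg x.vertex (zero_add _)

theorem eq_pre {η : FinPath Λ} {x y : InfinitePath k Λ} (hy : y ∈ cylinder k η)
    (hxy : shift (η.deg k) y = x) : y = pre η x := by
  have hx : x ∈ cylinder k (FinPath.ofVertex η.s) := hxy ▸ shift_mem hy
  exact (existsUnique_prefix η x (mem_cylinder_ofVertex.1 hx)).unique ⟨hy, hxy⟩ (pre_spec hx)

/-- The shift inverts the prefixing map, so an image becomes a preimage under a measurable map.
Measurability and measure of images are always obtained in this form. -/
theorem image_pre {η : FinPath Λ} {E : Set (InfinitePath k Λ)}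
    (hE : E ⊆ cylinder k (FinPath.ofVertex η.s)) :
    pre η '' E = cylinder k η ∩ shift (η.deg k) ⁻¹' E := by
  ext y
  constructor
  · rintro ⟨x, hx, rfl⟩
    have := pre_spec (hE hx)
    exact ⟨this.1, by rw [Set.mem_preimage, this.2]; exact hx⟩
  · rintro ⟨h1, h2⟩
    exact ⟨_, h2, (eq_pre h1 rfl).symm⟩

theorem image_pre_domain (η : FinPath Λ) :
    pre η '' cylinder k (FinPath.ofVertex η.s) = cylinder k η := by
  rw [image_pre subset_rfl]
  exact Set.inter_eq_left.2 fun x hx => shift_mem hx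

theorem deg_comp {a b c : Λ} (η : a ⟶ b) (ν : b ⟶ c) :
    FinPath.deg k ⟨a, c, η ≫ ν⟩ = FinPath.deg k ⟨a, b, η⟩ + FinPath.deg k ⟨b, c, ν⟩ :=
  KGraph.degree_comp η ν

theorem cylinder_comp {a b c : Λ} (η : a ⟶ b) (ν : b ⟶ c) :
    cylinder k ⟨a, c, η ≫ ν⟩ =
      cylinder k ⟨a, b, η⟩ ∩ shift (FinPath.deg k ⟨a, b, η⟩) ⁻¹' cylinder k ⟨b, c, ν⟩ := by
  ext x
  set m : Fin k → ℕ := FinPath.deg k ⟨a, b, η⟩ with hm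
  set n : Fin k → ℕ := FinPath.deg k ⟨b, c, ν⟩ with hn
  have h0 : ∀ n : Fin k → ℕ, 0 ≤ n := fun n _ => Nat.zero_le _
  have hle : m ≤ m + n := le_self_add
  have hsh : (x.shift m).seg 0 n (h0 n) = x.seg m (m + n) hle := by
    rw [seg_shift]
    exact seg_congr x (zero_add _) (add_comm _ _) _
  rw [mem_cylinder_iff_of_deg (deg_comp η ν), Set.mem_inter_iff, Set.mem_preimage,
    mem_cylinder_iff, mem_cylinder_iff, ← hm, ← hn]
  have hseg : x.seg 0 (m + n) (h0 _) = ⟨_, _, x.map (h0 m) ≫ x.map hle⟩ := by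
    rw [← x.map_trans]; rfl
  rw [hsh, hseg]
  constructor
  · intro h
    have h1 := FinPath.head_congr k h (by rw [x.degree_map, tsub_zero]; rfl)
    exact ⟨h1, FinPath.tail_congr k h1 h⟩
  · rintro ⟨h1, h2⟩
    exact FinPath.comp_congr h1 h2

theorem isOpen_cylinder (η : FinPath Λ) : IsOpen (cylinder k η) :=
  TopologicalSpace.isOpen_generateFrom_of_mem ⟨η, rfl⟩

theorem measurableSet_cylinder (η : FinPath Λ) : MeasurableSet (cylinder k η) :=
  (isOpen_cylinder η).measurableSet

theorem isOpen_of_seg {S : Set (InfinitePath k Λ)}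
    (h : ∀ x ∈ S, ∃ (m : Fin k → ℕ) (h : 0 ≤ m), ∀ y : InfinitePath k Λ,
      y.seg 0 m h = x.seg 0 m h → y ∈ S) : IsOpen S := by
  refine isOpen_iff_forall_mem_open.2 fun x hx => ?_
  obtain ⟨m, hm, hS⟩ := h x hx
  exact ⟨cylinder k (x.seg 0 m hm), fun y hy => hS y (mem_cylinder_seg.1 hy),
    isOpen_cylinder _, mem_cylinder_seg.2 rfl⟩

theorem continuous_shift (m : Fin k → ℕ) : Continuous (shift m : InfinitePath k Λ → _) := by
  refine continuous_generateFrom_iff.2 ?_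
  rintro _ ⟨η, rfl⟩
  refine isOpen_of_seg fun x hx => ⟨η.deg k + m, fun _ => Nat.zero_le _, fun y hy => ?_⟩
  rw [Set.mem_preimage, mem_cylinder_iff] at hx ⊢
  refine Eq.trans ?_ hx
  rw [seg_shift, seg_shift]
  exact seg_subpath hy (fun _ => Nat.zero_le _) _ le_rfl

theorem measurable_shift (m : Fin k → ℕ) : Measurable (shift m : InfinitePath k Λ → _) :=
  (continuous_shift m).measurable

/-- There are only countably many finite paths, and a countable subbasis generates the Borel
σ-algebra. -/
theorem measurableSpace_eq_generateFrom :
    (inferInstance : MeasurableSpace (InfinitePath k Λ)) =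
      MeasurableSpace.generateFrom (Set.range (cylinder k)) := by
  have := FinPath.countable (Λ := Λ) k
  have : SecondCountableTopology (InfinitePath k Λ) :=
    ⟨_, Set.countable_range (cylinder k), rfl⟩
  exact borel_eq_generateFrom_of_subbasis rfl

/-- The segment of `ηx` of degree `d(ν) + d(η)` is `η` followed by `x(0, d(ν))`, so `x(0, d(ν))`
decides whether `ηx` lies in `Z(ν)`. -/
theorem isOpen_pre_preimage (η ν : FinPath Λ) :
    IsOpen {x : InfinitePath k Λ | x ∈ cylinder k (FinPath.ofVertex η.s) ∧
      pre η x ∈ cylinder k ν} := by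
  refine isOpen_of_seg fun x hx => ⟨ν.deg k, fun _ => Nat.zero_le _, fun y hy => ?_⟩
  have hy0 : y ∈ cylinder k (FinPath.ofVertex η.s) := by
    rw [mem_cylinder_ofVertex, ← mem_cylinder_ofVertex.1 hx.1]
    exact vertex_eq_of_seg_eq hy le_rfl (fun _ => Nat.zero_le _)
  refine ⟨hy0, ?_⟩
  obtain ⟨hx1, hx2⟩ := pre_spec hx.1
  obtain ⟨hy1, hy2⟩ := pre_spec hy0
  have hle : η.deg k ≤ ν.deg k + η.deg k := le_add_self
  have h1 : (pre η y).seg 0 (η.deg k) (fun _ => Nat.zero_le _) =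
      (pre η x).seg 0 (η.deg k) (fun _ => Nat.zero_le _) := hy1.trans hx1.symm
  have h2 : (pre η y).seg (η.deg k) (ν.deg k + η.deg k) hle =
      (pre η x).seg (η.deg k) (ν.deg k + η.deg k) hle := by
    rw [← hy2, ← hx2, seg_shift, seg_shift] at hy
    rwa [seg_congr (pre η y) (zero_add _).symm rfl, seg_congr (pre η x) (zero_add _).symm rfl]
  exact (seg_subpath (seg_trans_congr _ _ h1 h2) le_rfl (fun _ => Nat.zero_le _)
    le_self_add).trans hx.2

theorem measurable_pre (η : FinPath Λ) :
    Measurable fun x : cylinder k (FinPath.ofVertex η.s) => pre η x.1 := by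
  have h := measurableSpace_eq_generateFrom (k := k) (Λ := Λ)
  change @Measurable _ _ _ (inferInstance : MeasurableSpace (InfinitePath k Λ)) _
  rw [h]
  refine measurable_generateFrom ?_
  rintro _ ⟨ν, rfl⟩
  convert measurable_subtype_coe (isOpen_pre_preimage η ν).measurableSet using 1
  ext x
  exact ⟨fun hx => ⟨x.2, hx⟩, fun hx => hx.2⟩

/-- An increasing sequence of finite paths with cofinal degrees is the sequence of initial segments
of an infinite path. -/
theorem exists_limit {a : Λ} (b : ℕ → Λ) (z : ∀ n, a ⟶ b n) (g : ∀ n, b n ⟶ b (n + 1))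
    (hz : ∀ n, z n ≫ g n = z (n + 1))
    (hcof : ∀ m : Fin k → ℕ, ∃ n, m ≤ KGraph.degree (z n)) :
    ∃ y : InfinitePath k Λ, ∀ n,
      y.seg 0 (KGraph.degree (z n)) (fun _ => Nat.zero_le _) = ⟨a, b n, z n⟩ := by
  have h0 : ∀ n : Fin k → ℕ, 0 ≤ n := fun n _ => Nat.zero_le _
  have hext : ∀ {n n'}, n ≤ n' → ∃ γ : b n ⟶ b n', z n ≫ γ = z n' := fun {n n'} h => by
    induction n', h using Nat.le_induction with
    | base => exact ⟨𝟙 _, Category.comp_id _⟩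
    | succ n' _ ih =>
      obtain ⟨γ, hγ⟩ := ih
      exact ⟨γ ≫ g n', by rw [← Category.assoc, hγ, hz]⟩
  -- The vertex at position `p` and the segment `f p` leading to it are cut out of some `z n` whose
  -- degree is at least `p`; `hhead` shows that the choice of `n` does not matter.
  have hfac : ∀ p : Fin k → ℕ, ∃ n : ℕ, ∃ c : Λ, ∃ f : a ⟶ c, ∃ γ : c ⟶ b n,
      KGraph.degree (k := k) f = p ∧ f ≫ γ = z n := fun p => by
    obtain ⟨n, hn⟩ := hcof p
    obtain ⟨⟨c, f, γ⟩, ⟨hf, _, hfg⟩, _⟩ := KGraph.factorization (z n) p _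
      (add_tsub_cancel_of_le hn).symm
    exact ⟨n, c, f, γ, hf, hfg⟩
  choose l c f γ hf hfγ using hfac
  have hhead : ∀ {p n} {d : Λ} (φ : a ⟶ d) (δ : d ⟶ b n),
      KGraph.degree (k := k) φ = p → φ ≫ δ = z n →
        (⟨a, c p, f p⟩ : FinPath Λ) = ⟨a, d, φ⟩ := fun {p n d} φ δ hφ hδ => by
    obtain ⟨g₁, hg₁⟩ := hext (le_max_left (l p) n)
    obtain ⟨g₂, hg₂⟩ := hext (le_max_right (l p) n)
    refine head_eq k (f p) (γ p ≫ g₁) φ (δ ≫ g₂) ?_ ((hf p).trans hφ.symm)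
    rw [← Category.assoc, hfγ, hg₁, ← Category.assoc, hδ, hg₂]
  have hstep : ∀ {p q} (_ : p ≤ q), ∃ e : c p ⟶ c q, f p ≫ e = f q := fun {p q} h => by
    obtain ⟨⟨d, φ, δ⟩, ⟨h1, _, h3⟩, _⟩ := KGraph.factorization (f q) p (q - p)
      (by rw [hf, add_tsub_cancel_of_le h])
    have := hhead φ (δ ≫ γ q) h1 (by rw [← Category.assoc, h3, hfγ])
    simp only [] at h3
    cases this
    exact ⟨δ, h3⟩
  choose e he using @hstep
  let y : InfinitePath k Λ :=
    { vertex := c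
      map := fun h => e h
      map_refl := fun p => left_cancel k (f p) _ _ (by rw [he, Category.comp_id])
      map_trans := fun {p q t} h h' => left_cancel k (f p) _ _ (by
        rw [he, ← Category.assoc, he, he])
      degree_map := fun {p q} h => by
        have := congrArg (KGraph.degree (k := k)) (he h)
        rw [KGraph.degree_comp, hf, hf] at this
        exact eq_tsub_of_add_eq ((add_comm _ _).trans this) }
  have hf0 : (⟨a, c 0, f 0⟩ : FinPath Λ) = ⟨a, a, 𝟙 a⟩ :=
    hhead (𝟙 a) (z 0) (KGraph.degree_id _) (Category.id_comp _)
  refine ⟨y, fun n => ?_⟩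
  refine tail_eq k hf0 ?_
  change (⟨a, _, f 0 ≫ e (h0 _)⟩ : FinPath Λ) = _
  rw [he, Category.id_comp]
  exact hhead (z n) (𝟙 _) rfl (Category.comp_id _)

end InfinitePath

/-! ### A null-set criterion for semibranching systems -/

open InfinitePath

/-- The standard maps form a `Λ`-semibranching function system as soon as all of them are
nonsingular in both directions. -/
theorem standardMapsSemibranching_of_quasiInvariant {k : ℕ} {Λ : Type u} [Category.{w} Λ]
    [KGraph k Λ] (μ : Measure (InfinitePath k Λ)) [IsFiniteMeasure μ]
    (hpos : ∀ a : Λ, 0 < μ (cylinder k (FinPath.ofVertex a)))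
    (hqi : ∀ (η : FinPath Λ) (E : Set (InfinitePath k Λ)), MeasurableSet E →
      (μ (cylinder k η ∩ shift (η.deg k) ⁻¹' E) = 0 ↔
        μ (cylinder k (FinPath.ofVertex η.s) ∩ E) = 0)) :
    StandardMapsSemibranching k μ where
  semibranching m :=
    { measurableSet_domain := fun _ => measurableSet_cylinder _
      measurable_map := fun η => by
        exact measurable_pre η.1
      cover := by
        have : (⋃ i : {η : FinPath Λ // η.deg k = m},
            pre i.1 '' cylinder k (FinPath.ofVertex i.1.s)) = Set.univ := by
          refine Set.eq_univ_of_forall fun x => Set.mem_iUnion.2 ?_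
          refine ⟨⟨x.seg 0 m (fun _ => Nat.zero_le _), by rw [deg_seg, tsub_zero]⟩, ?_⟩
          rw [image_pre_domain]
          exact mem_cylinder_seg.2 rfl
        rw [this]; simp
      disjoint := fun i j hij => by
        rw [image_pre_domain, image_pre_domain]
        have : cylinder k i.1 ∩ cylinder k j.1 = ∅ := by
          refine Set.eq_empty_of_forall_notMem fun x hx => hij (Subtype.ext ?_)
          rw [← (mem_cylinder_iff_of_deg i.2).1 hx.1, (mem_cylinder_iff_of_deg j.2).1 hx.2]
        rw [this]; simp
      derivative := fun η => by
        obtain ⟨η, hη⟩ := η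
        simp only
        -- For `E ⊆ Z(s(η))` this measure gives `μ (pre η '' E)`, so its density with respect to `μ`
        -- is the derivative sought. The density is finite almost everywhere, which makes the
        -- passage to `ℝ≥0` harmless.
        set ν : Measure (InfinitePath k Λ) :=
          (μ.restrict (cylinder k η)).map (shift (η.deg k)) with hν
        have hνE : ∀ E, MeasurableSet E → ν E = μ (cylinder k η ∩ shift (η.deg k) ⁻¹' E) :=
          fun E hE => by
            rw [hν, Measure.map_apply (measurable_shift _) hE,
              Measure.restrict_apply (measurable_shift _ hE), Set.inter_comm]
        have hac : ν ≪ μ := Measure.AbsolutelyContinuous.mk fun E hE h => by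
          rw [hνE E hE]
          exact (hqi η E hE).2 (measure_mono_null Set.inter_subset_right h)
        have hrn : ∀ E, ν E = ∫⁻ x in E, ((ν.rnDeriv μ x).toNNReal : ℝ≥0∞) ∂μ := fun E => by
          rw [← Measure.setLIntegral_rnDeriv hac E]
          refine lintegral_congr_ae (ae_restrict_of_ae ?_)
          filter_upwards [Measure.rnDeriv_lt_top ν μ] with x hx
          rw [ENNReal.coe_toNNReal hx.ne]
        have hm : Measurable fun x => (ν.rnDeriv μ x).toNNReal :=
          (Measure.measurable_rnDeriv ν μ).ennreal_toNNReal
        refine ⟨fun x => (ν.rnDeriv μ x).toNNReal, hm, fun E hE hEm => ?_, ?_⟩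
        · rw [image_pre hE, ← hrn, hνE E hEm]
          exact ⟨(measurableSet_cylinder η).inter (measurable_shift _ hEm), rfl⟩
        -- `ν` vanishes on the zero set of its density, and the forward half of `hqi` makes that set
        -- `μ`-null inside the domain.
        · set Z := {x | (ν.rnDeriv μ x).toNNReal = 0} with hZ
          have hZm : MeasurableSet Z := hm (measurableSet_singleton 0)
          have h0 : ν Z = 0 := by
            rw [hrn, setLIntegral_congr_fun (g := fun _ => 0) hZm]
            · simp
            · intro x hx
              have : (ν.rnDeriv μ x).toNNReal = 0 := hx
              simp only [this, ENNReal.coe_zero]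
          rw [hνE Z hZm, hqi η Z hZm] at h0
          rw [ae_iff, Measure.restrict_apply' (measurableSet_cylinder _)]
          convert h0 using 2
          rw [Set.inter_comm]
          congr 1
          ext x
          simp [hZ] }
  coding m :=
    { measurable := measurable_shift m
      left_inverse := fun η x hx => by
        have := (pre_spec hx).2
        rwa [η.2] at this }
  vertex_map a x hx := by
    have := (pre_spec (η := FinPath.ofVertex a) hx).2
    rwa [deg_ofVertex, shift_zero] at this
  vertex_pos := hpos
  range_subset η ν := by
    rw [image_pre_domain]
    refine measure_mono_null (fun x hx => hx.2 ?_) measure_empty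
    exact mem_cylinder_ofVertex.2 (vertex_zero_of_mem hx.1)
  domain_comp η ν := Filter.EventuallyEq.rfl
  map_comp {a b c} η ν := by
    refine ae_restrict_of_forall_mem (measurableSet_cylinder _) fun x hx => ?_
    have h1 := pre_spec (η := ⟨b, c, ν⟩) hx
    have h2 := pre_spec (η := ⟨a, b, η⟩) (x := pre ⟨b, c, ν⟩ x)
      (mem_cylinder_ofVertex.2 (vertex_zero_of_mem h1.1))
    refine eq_pre (η := ⟨a, c, η ≫ ν⟩) ?_ ?_
    · rw [cylinder_comp]
      exact ⟨h2.1, by rw [Set.mem_preimage, h2.2]; exact h1.1⟩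
    · rw [deg_comp, add_comm, ← shift_shift, h2.2, h1.2]
  coding_comp m n := funext fun x => shift_shift m n x

/-! ## Coding the infinite paths of `Λ_{2N}` by sequences -/

/-- The degree of the `n`-th edge of an alternating red-blue path. -/
def altColor (n : ℕ) : Fin 2 → ℕ := if Even n then red else blue

/-- The degree of the alternating red-blue path with `n` edges. -/
def altDegree : ℕ → Fin 2 → ℕ
  | 0 => 0
  | n + 1 => altDegree n + altColor n

theorem altColor_mem (n : ℕ) : altColor n ∈ ({blue, red} : Set (Fin 2 → ℕ)) := by
  unfold altColor
  split_ifs <;> simp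

theorem altDegree_two_mul (t : ℕ) : altDegree (2 * t) = t • (red + blue) := by
  induction t with
  | zero => simp [altDegree]
  | succ t ih =>
    have h1 : altColor (2 * t) = red := if_pos (even_two_mul t)
    have h2 : altColor (2 * t + 1) = blue := if_neg (by simp)
    rw [mul_add, mul_one, altDegree, altDegree, ih, h1, h2, add_smul, one_smul, add_assoc]

theorem altDegree_two_mul_add_one (t : ℕ) :
    altDegree (2 * t + 1) = t • (red + blue) + red := by
  rw [altDegree, altDegree_two_mul, altColor, if_pos (even_two_mul t)]

/-- Cofinality of the diagonal degrees is what lets the alternating path determine the whole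
infinite path. -/
theorem le_altDegree_two_mul (m : Fin 2 → ℕ) : ∃ t : ℕ, m ≤ t • (red + blue) := by
  refine ⟨m 0 + m 1, fun i => ?_⟩
  fin_cases i <;> simp [red, blue]

theorem nat_zero_le_fun {k : ℕ} (p : Fin k → ℕ) : 0 ≤ p := fun _ => Nat.zero_le _

namespace IsLambda2N

variable {N : ℕ} {φ : Equiv.Perm (Fin (2 * N))} {Λ : Type u} [Category.{w} Λ] [KGraph 2 Λ]
  {v : Λ} {Q : Fin (2 * N) → Λ}

theorem edge_ends (hΛ : IsLambda2N φ v Q) {c : Fin 2 → ℕ} (hc : c ∈ ({blue, red} : Set _))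
    {a b : Λ} (f : a ⟶ b) (hf : KGraph.degree f = c) :
    (a = v ∧ ∃ i, b = Q i) ∨ ((∃ i, a = Q i) ∧ b = v) := by
  rcases hΛ.vertex_cases a with rfl | ⟨i, rfl⟩ <;> rcases hΛ.vertex_cases b with rfl | ⟨j, rfl⟩
  · exact absurd hf (hΛ.no_edge_center_center c hc f)
  · exact Or.inl ⟨rfl, j, rfl⟩
  · exact Or.inr ⟨⟨i, rfl⟩, rfl⟩
  · exact absurd hf (hΛ.no_edge_outer_outer c hc i j f)

theorem edge_unique (hΛ : IsLambda2N φ v Q) {c : Fin 2 → ℕ} (hc : c ∈ ({blue, red} : Set _))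
    {η ν : FinPath Λ} (hη : η.deg 2 = c) (hν : ν.deg 2 = c) (hr : η.r = ν.r) (hs : η.s = ν.s) :
    η = ν := by
  obtain ⟨a, b, f⟩ := η
  obtain ⟨a', b', g⟩ := ν
  obtain rfl : a = a' := hr
  obtain rfl : b = b' := hs
  refine FinPath.eq_iff_of_endpoints.2 ?_
  rcases hΛ.edge_ends hc f hη with ⟨rfl, i, rfl⟩ | ⟨⟨i, rfl⟩, rfl⟩
  · exact (hΛ.edge_center_outer c hc i).unique hη hν
  · exact (hΛ.edge_outer_center c hc i).unique hη hν

theorem degree_map_add (ξ : InfinitePath 2 Λ) (p c : Fin 2 → ℕ) :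
    KGraph.degree (ξ.map (le_self_add : p ≤ p + c)) = c := by
  rw [ξ.degree_map, add_tsub_cancel_left]

theorem vertex_of_center (hΛ : IsLambda2N φ v Q) {c : Fin 2 → ℕ}
    (hc : c ∈ ({blue, red} : Set _)) {ξ : InfinitePath 2 Λ} {p : Fin 2 → ℕ}
    (h : ξ.vertex p = v) : ∃ i, ξ.vertex (p + c) = Q i := by
  rcases hΛ.edge_ends hc _ (degree_map_add ξ p c) with ⟨-, hi⟩ | ⟨⟨i, hi⟩, -⟩
  · exact hi
  · exact absurd (hi.symm.trans h) (hΛ.outer_ne_center i)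

theorem vertex_of_outer (hΛ : IsLambda2N φ v Q) {c : Fin 2 → ℕ}
    (hc : c ∈ ({blue, red} : Set _)) {ξ : InfinitePath 2 Λ} {p : Fin 2 → ℕ}
    {i : Fin (2 * N)} (h : ξ.vertex p = Q i) : ξ.vertex (p + c) = v := by
  rcases hΛ.edge_ends hc _ (degree_map_add ξ p c) with ⟨hv, -⟩ | ⟨-, hv⟩
  · exact absurd (h.symm.trans hv) (hΛ.outer_ne_center i)
  · exact hv

theorem blue_mem : blue ∈ ({blue, red} : Set (Fin 2 → ℕ)) := Or.inl rfl

theorem red_mem : red ∈ ({blue, red} : Set (Fin 2 → ℕ)) := Or.inr rfl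

/-- The segment of degree `red + blue` at `p` is the red-blue path through `Q i`. The rule rewrites
it as the blue-red path through `Q (φ i)`, and unique factorization identifies the blue edge of `ξ`
with the first edge of the latter. -/
theorem vertex_blue_of_red (hΛ : IsLambda2N φ v Q) {ξ : InfinitePath 2 Λ} {p : Fin 2 → ℕ}
    {i : Fin (2 * N)} (h : ξ.vertex p = v) (hi : ξ.vertex (p + red) = Q i) :
    ξ.vertex (p + blue) = Q (φ i) := by
  obtain ⟨f, hf, -⟩ := hΛ.edge_center_outer red red_mem i
  obtain ⟨g, hg, -⟩ := hΛ.edge_outer_center blue blue_mem i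
  obtain ⟨f', hf', -⟩ := hΛ.edge_center_outer blue blue_mem (φ i)
  obtain ⟨g', hg', -⟩ := hΛ.edge_outer_center red red_mem (φ i)
  have h1 : (⟨_, _, ξ.map (le_self_add : p ≤ p + red)⟩ : FinPath Λ) = ⟨_, _, f⟩ :=
    hΛ.edge_unique red_mem (degree_map_add ξ p red) hf h hi
  have h2 : (⟨_, _, ξ.map (le_self_add : p + red ≤ p + red + blue)⟩ : FinPath Λ) = ⟨_, _, g⟩ :=
    hΛ.edge_unique blue_mem (degree_map_add ξ _ blue) hg hi (hΛ.vertex_of_outer blue_mem hi)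
  have h3 := FinPath.comp_congr h1 h2
  have hle : p + blue ≤ p + red + blue := add_le_add le_self_add le_rfl
  rw [hΛ.factorization_rule i f g f' g' hf hg hf' hg', ← ξ.map_trans,
    ξ.map_trans (le_self_add : p ≤ p + blue) hle] at h3
  exact congrArg FinPath.s
    (FinPath.head_congr 2 h3 ((degree_map_add ξ p blue).trans hf'.symm))

theorem vertex_blue_iff (hΛ : IsLambda2N φ v Q) {ξ : InfinitePath 2 Λ} {p : Fin 2 → ℕ}
    (h : ξ.vertex p = v) (i : Fin (2 * N)) :
    ξ.vertex (p + red) = Q i ↔ ξ.vertex (p + blue) = Q (φ i) := by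
  refine ⟨hΛ.vertex_blue_of_red h, fun hb => ?_⟩
  obtain ⟨j, hj⟩ := hΛ.vertex_of_center red_mem h
  have := (hΛ.vertex_blue_of_red h hj).symm.trans hb
  rw [hj, φ.injective (hΛ.outer_injective this)]

/-- The factorization rule, for an edge of either color compared with a red edge. -/
theorem exists_vertex_color_iff (hΛ : IsLambda2N φ v Q) {c : Fin 2 → ℕ}
    (hc : c ∈ ({blue, red} : Set _)) :
    ∃ ψ : Equiv.Perm (Fin (2 * N)), (ψ = 1 ∨ ψ = φ) ∧
      ∀ (ξ : InfinitePath 2 Λ) (p : Fin 2 → ℕ), ξ.vertex p = v → ∀ i,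
        (ξ.vertex (p + red) = Q i ↔ ξ.vertex (p + c) = Q (ψ i)) := by
  rcases hc with rfl | rfl
  · exact ⟨φ, Or.inr rfl, fun ξ p h i => hΛ.vertex_blue_iff h i⟩
  · exact ⟨1, Or.inl rfl, fun ξ p h i => Iff.rfl⟩

theorem vertex_add_smul_of_center (hΛ : IsLambda2N φ v Q) {ξ : InfinitePath 2 Λ}
    {p : Fin 2 → ℕ} (h : ξ.vertex p = v) (t : ℕ) : ξ.vertex (t • (red + blue) + p) = v := by
  induction t with
  | zero => simpa using h
  | succ t ih =>
    obtain ⟨i, hi⟩ := hΛ.vertex_of_center red_mem ih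
    have := hΛ.vertex_of_outer blue_mem hi
    rwa [add_assoc, add_right_comm, ← succ_nsmul] at this

theorem vertex_smul_of_center (hΛ : IsLambda2N φ v Q) {ξ : InfinitePath 2 Λ}
    (h : ξ.vertex 0 = v) (t : ℕ) : ξ.vertex (t • (red + blue)) = v := by
  simpa using hΛ.vertex_add_smul_of_center h t

theorem vertex_smul_add_of_outer (hΛ : IsLambda2N φ v Q) {c : Fin 2 → ℕ}
    (hc : c ∈ ({blue, red} : Set _)) {ξ : InfinitePath 2 Λ} {i : Fin (2 * N)}
    (h : ξ.vertex 0 = Q i) (t : ℕ) : ξ.vertex (t • (red + blue) + c) = v := by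
  refine hΛ.vertex_add_smul_of_center ?_ t
  simpa using hΛ.vertex_of_outer hc h

theorem exists_coding (hΛ : IsLambda2N φ v Q) (ξ : InfinitePath 2 Λ) :
    (ξ.vertex 0 = v ∧ ∃ a : ℕ → Fin (2 * N), ∀ t : ℕ, ξ.vertex (t • (red + blue) + red) = Q (a t)) ∨
      (ξ.vertex 0 ≠ v ∧ ∃ a : ℕ → Fin (2 * N), ∀ t : ℕ, ξ.vertex (t • (red + blue)) = Q (a t)) := by
  rcases hΛ.vertex_cases (ξ.vertex 0) with h | ⟨i, h⟩
  · refine Or.inl ⟨h, ?_⟩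
    have := fun t => hΛ.vertex_of_center red_mem (hΛ.vertex_smul_of_center h t)
    choose a ha using this
    exact ⟨a, ha⟩
  · refine Or.inr ⟨h ▸ hΛ.outer_ne_center i, ?_⟩
    have : ∀ t : ℕ, ∃ j, ξ.vertex (t • (red + blue)) = Q j := by
      rintro (_ | t)
      · exact ⟨i, by simpa using h⟩
      · have := hΛ.vertex_of_center blue_mem (hΛ.vertex_smul_add_of_outer red_mem h t)
        rwa [add_assoc, ← succ_nsmul] at this
    choose a ha using this
    exact ⟨a, ha⟩

theorem seg_zero_congr {ξ ζ : InfinitePath 2 Λ} (h : ξ.vertex 0 = ζ.vertex 0) :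
    ξ.seg 0 0 le_rfl = ζ.seg 0 0 le_rfl := by
  have h1 := mem_cylinder_ofVertex.2 h
  have h2 := mem_cylinder_ofVertex.2 (rfl : ζ.vertex 0 = _)
  rw [mem_cylinder_iff_of_deg (deg_ofVertex _)] at h1 h2
  exact h1.trans h2.symm

/-- Each edge of the alternating path is determined by its color and its endpoints, so the segments
agree edge by edge. -/
theorem seg_eq_of_vertex_eq (hΛ : IsLambda2N φ v Q) {ξ ζ : InfinitePath 2 Λ} {n : ℕ}
    (h : ∀ j ≤ n, ξ.vertex (altDegree j) = ζ.vertex (altDegree j)) :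
    ξ.seg 0 (altDegree n) (nat_zero_le_fun _) = ζ.seg 0 (altDegree n) (nat_zero_le_fun _) := by
  induction n with
  | zero => exact seg_zero_congr (h 0 le_rfl)
  | succ n ih =>
    refine seg_trans_congr (nat_zero_le_fun _) le_self_add (ih fun j hj => h j (by omega)) ?_
    exact hΛ.edge_unique (altColor_mem n) (degree_map_add ξ _ _) (degree_map_add ζ _ _)
      (h n (by omega)) (h (n + 1) le_rfl)

theorem exists_edge (hΛ : IsLambda2N φ v Q) {c : Fin 2 → ℕ} (hc : c ∈ ({blue, red} : Set _))
    {a b : Λ} (h : (a = v ∧ ∃ i, b = Q i) ∨ ((∃ i, a = Q i) ∧ b = v)) :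
    ∃ f : a ⟶ b, KGraph.degree f = c := by
  rcases h with ⟨rfl, i, rfl⟩ | ⟨⟨i, rfl⟩, rfl⟩
  exacts [(hΛ.edge_center_outer c hc i).exists, (hΛ.edge_outer_center c hc i).exists]

/-- The concatenations of the chosen edges have cofinal degrees, so they have a limit path. -/
theorem exists_path (w : ℕ → Λ)
    (hw : ∀ n, ∃ f : w n ⟶ w (n + 1), KGraph.degree f = altColor n) :
    ∃ ξ : InfinitePath 2 Λ, ∀ n, ξ.vertex (altDegree n) = w n := by
  choose f hf using hw
  let z : ∀ n, w 0 ⟶ w n := fun n => Nat.rec (𝟙 _) (fun n g => g ≫ f n) n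
  have hz : ∀ n, KGraph.degree (k := 2) (z n) = altDegree n := by
    intro n
    induction n with
    | zero => exact KGraph.degree_id _
    | succ n ih =>
      change KGraph.degree (z n ≫ f n) = _
      rw [KGraph.degree_comp, ih, hf, altDegree]
  obtain ⟨ξ, hξ⟩ := exists_limit (k := 2) w z f (fun _ => rfl) fun m => by
    obtain ⟨t, ht⟩ := le_altDegree_two_mul m
    exact ⟨2 * t, by rwa [hz, altDegree_two_mul]⟩
  refine ⟨ξ, fun n => ?_⟩
  have := congrArg FinPath.s (hξ n)
  rw [← hz n]
  exact this

theorem exists_center (hΛ : IsLambda2N φ v Q) (a : ℕ → Fin (2 * N)) :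
    ∃ ξ : InfinitePath 2 Λ, ξ.vertex 0 = v ∧ ∀ t : ℕ, ξ.vertex (t • (red + blue) + red) = Q (a t) := by
  obtain ⟨ξ, hξ⟩ := exists_path (fun n => if Even n then v else Q (a (n / 2))) fun n => by
    obtain ⟨t, rfl | rfl⟩ := Nat.even_or_odd' n
    · have h1 : ¬ Even (2 * t + 1) := by simp
      have h2 : Even (2 * t) := even_two_mul t
      exact hΛ.exists_edge (altColor_mem _) (Or.inl ⟨if_pos h2, _, if_neg h1⟩)
    · have h1 : ¬ Even (2 * t + 1) := by simp
      have h2 : Even (2 * t + 1 + 1) := ⟨t + 1, by ring⟩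
      exact hΛ.exists_edge (altColor_mem _) (Or.inr ⟨⟨_, if_neg h1⟩, if_pos h2⟩)
  refine ⟨ξ, by simpa [altDegree] using hξ 0, fun t => ?_⟩
  rw [← altDegree_two_mul_add_one, hξ, if_neg (by simp)]
  congr 2
  omega

theorem exists_outer (hΛ : IsLambda2N φ v Q) (a : ℕ → Fin (2 * N)) :
    ∃ ξ : InfinitePath 2 Λ, ∀ t : ℕ, ξ.vertex (t • (red + blue)) = Q (a t) := by
  obtain ⟨ξ, hξ⟩ := exists_path (fun n => if Even n then Q (a (n / 2)) else v) fun n => by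
    obtain ⟨t, rfl | rfl⟩ := Nat.even_or_odd' n
    · have h1 : ¬ Even (2 * t + 1) := by simp
      have h2 : Even (2 * t) := even_two_mul t
      exact hΛ.exists_edge (altColor_mem _) (Or.inr ⟨⟨_, if_pos h2⟩, if_neg h1⟩)
    · have h1 : ¬ Even (2 * t + 1) := by simp
      have h2 : Even (2 * t + 1 + 1) := ⟨t + 1, by ring⟩
      exact hΛ.exists_edge (altColor_mem _) (Or.inl ⟨if_neg h1, _, if_pos h2⟩)
  refine ⟨ξ, fun t => ?_⟩
  rw [← altDegree_two_mul, hξ, if_pos (even_two_mul t)]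
  congr 2
  omega

/-! ### Coding cylinders as a countable generating π-system -/

theorem seg_eq_of_mem_center (hΛ : IsLambda2N φ v Q) {n : ℕ} {a : Fin (n + 1) → Fin (2 * N)}
    {ξ ζ : InfinitePath 2 Λ} (hξ : ξ ∈ centerCylinder v Q a) (hζ : ζ ∈ centerCylinder v Q a) :
    ξ.seg 0 (n • (red + blue) + red) (nat_zero_le_fun _) =
      ζ.seg 0 (n • (red + blue) + red) (nat_zero_le_fun _) := by
  have := hΛ.seg_eq_of_vertex_eq (ξ := ξ) (ζ := ζ) (n := 2 * n + 1) fun j hj => by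
    obtain ⟨t, rfl | rfl⟩ := Nat.even_or_odd' j
    · rw [altDegree_two_mul, hΛ.vertex_smul_of_center hξ.1, hΛ.vertex_smul_of_center hζ.1]
    · rw [altDegree_two_mul_add_one, hξ.2 ⟨t, by omega⟩, hζ.2 ⟨t, by omega⟩]
  rwa [seg_congr ξ rfl (altDegree_two_mul_add_one n).symm,
    seg_congr ζ rfl (altDegree_two_mul_add_one n).symm]

theorem outer_vertex_zero {n : ℕ} {a : Fin (n + 1) → Fin (2 * N)}
    {ξ : InfinitePath 2 Λ} (hξ : ξ ∈ outerCylinder Q a) : ξ.vertex 0 = Q (a 0) := by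
  simpa using hξ 0

theorem seg_eq_of_mem_outer (hΛ : IsLambda2N φ v Q) {n : ℕ} {a : Fin (n + 1) → Fin (2 * N)}
    {ξ ζ : InfinitePath 2 Λ} (hξ : ξ ∈ outerCylinder Q a) (hζ : ζ ∈ outerCylinder Q a) :
    ξ.seg 0 (n • (red + blue)) (nat_zero_le_fun _) =
      ζ.seg 0 (n • (red + blue)) (nat_zero_le_fun _) := by
  have := hΛ.seg_eq_of_vertex_eq (ξ := ξ) (ζ := ζ) (n := 2 * n) fun j hj => by
    obtain ⟨t, rfl | rfl⟩ := Nat.even_or_odd' j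
    · rw [altDegree_two_mul, hξ ⟨t, by omega⟩, hζ ⟨t, by omega⟩]
    · rw [altDegree_two_mul_add_one, hΛ.vertex_smul_add_of_outer red_mem (outer_vertex_zero hξ),
        hΛ.vertex_smul_add_of_outer red_mem (outer_vertex_zero hζ)]
  rwa [seg_congr ξ rfl (altDegree_two_mul n).symm, seg_congr ζ rfl (altDegree_two_mul n).symm]

/-- A cylinder of the first copy of the sequence space is the cylinder of a finite path. -/
theorem centerCylinder_eq (hΛ : IsLambda2N φ v Q) {n : ℕ} (a : Fin (n + 1) → Fin (2 * N)) :
    ∃ η : FinPath Λ, η.deg 2 = n • (red + blue) + red ∧ η.s = Q (a (Fin.last n)) ∧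
      centerCylinder v Q a = cylinder 2 η := by
  -- Any path in the cylinder would do; this one repeats the last letter of the word forever.
  obtain ⟨ξ, h0, hξ⟩ := hΛ.exists_center fun t => a ⟨min t n, by omega⟩
  have hmem : ξ ∈ centerCylinder v Q a := ⟨h0, fun t => by
    rw [hξ]; congr 2; ext; simp; omega⟩
  refine ⟨ξ.seg 0 (n • (red + blue) + red) (nat_zero_le_fun _), ?_, ?_, ?_⟩
  · rw [deg_seg, tsub_zero]
  · exact hmem.2 (Fin.last n)
  · ext ζ
    rw [mem_cylinder_seg]
    refine ⟨fun hζ => hΛ.seg_eq_of_mem_center hζ hmem, fun h => ⟨?_, fun t => ?_⟩⟩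
    · rw [vertex_eq_of_seg_eq h le_rfl (nat_zero_le_fun _), h0]
    · rw [← hmem.2 t]
      refine vertex_eq_of_seg_eq h (nat_zero_le_fun _) (add_le_add ?_ le_rfl)
      exact nsmul_le_nsmul_left (nat_zero_le_fun _) (by omega)

/-- A cylinder of the second copy of the sequence space is the cylinder of a finite path. -/
theorem outerCylinder_eq (hΛ : IsLambda2N φ v Q) {n : ℕ} (a : Fin (n + 1) → Fin (2 * N)) :
    ∃ η : FinPath Λ, η.deg 2 = n • (red + blue) ∧ η.s = Q (a (Fin.last n)) ∧
      outerCylinder Q a = cylinder 2 η := by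
  obtain ⟨ξ, hξ⟩ := hΛ.exists_outer fun t => a ⟨min t n, by omega⟩
  have hmem : ξ ∈ outerCylinder Q a := fun t => by
    rw [hξ]; congr 2; ext; simp; omega
  refine ⟨ξ.seg 0 (n • (red + blue)) (nat_zero_le_fun _), ?_, ?_, ?_⟩
  · rw [deg_seg, tsub_zero]
  · exact hmem (Fin.last n)
  · ext ζ
    rw [mem_cylinder_seg]
    refine ⟨fun hζ => hΛ.seg_eq_of_mem_outer hζ hmem, fun h t => ?_⟩
    rw [← hmem t]
    refine vertex_eq_of_seg_eq h (nat_zero_le_fun _) ?_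
    exact nsmul_le_nsmul_left (nat_zero_le_fun _) (by omega)

theorem measurableSet_center (hΛ : IsLambda2N φ v Q) {n : ℕ} (a : Fin (n + 1) → Fin (2 * N)) :
    MeasurableSet (centerCylinder v Q a) := by
  obtain ⟨η, -, -, h⟩ := hΛ.centerCylinder_eq a
  exact h ▸ measurableSet_cylinder η

theorem measurableSet_outer (hΛ : IsLambda2N φ v Q) {n : ℕ} (a : Fin (n + 1) → Fin (2 * N)) :
    MeasurableSet (outerCylinder Q a) := by
  obtain ⟨η, -, -, h⟩ := hΛ.outerCylinder_eq a
  exact h ▸ measurableSet_cylinder η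

variable (v Q) in
/-- All cylinder sets of the two copies of the sequence space. -/
def cylinders : Set (Set (InfinitePath 2 Λ)) :=
  {S | ∃ (n : ℕ) (a : Fin (n + 1) → Fin (2 * N)), S = centerCylinder v Q a} ∪
    {S | ∃ (n : ℕ) (a : Fin (n + 1) → Fin (2 * N)), S = outerCylinder Q a}

theorem countable_cylinders : (cylinders v Q).Countable := by
  refine Set.Countable.union ?_ ?_
  · refine (Set.countable_range fun p : Σ n : ℕ, (Fin (n + 1) → Fin (2 * N)) =>
      centerCylinder v Q p.2).mono ?_
    rintro _ ⟨n, a, rfl⟩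
    exact ⟨⟨n, a⟩, rfl⟩
  · refine (Set.countable_range fun p : Σ n : ℕ, (Fin (n + 1) → Fin (2 * N)) =>
      outerCylinder Q p.2).mono ?_
    rintro _ ⟨n, a, rfl⟩
    exact ⟨⟨n, a⟩, rfl⟩

/-- If one path follows both words, the longer word extends the shorter one; cylinders are thus
nested or disjoint. -/
theorem centerCylinder_inter {m n : ℕ} (hmn : m ≤ n)
    {a : Fin (m + 1) → Fin (2 * N)} {b : Fin (n + 1) → Fin (2 * N)}
    (h : (centerCylinder v Q a ∩ centerCylinder v Q b).Nonempty) :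
    centerCylinder v Q a ∩ centerCylinder v Q b = centerCylinder v Q b := by
  obtain ⟨ξ, h1, h2⟩ := h
  refine Set.inter_eq_right.2 fun ζ hζ => ⟨hζ.1, fun t => ?_⟩
  have h3 := h2.2 ⟨t, by omega⟩
  rw [h1.2 t] at h3
  rw [h3]
  exact hζ.2 ⟨t, by omega⟩

theorem outerCylinder_inter {m n : ℕ} (hmn : m ≤ n)
    {a : Fin (m + 1) → Fin (2 * N)} {b : Fin (n + 1) → Fin (2 * N)}
    (h : (outerCylinder Q a ∩ outerCylinder Q b : Set (InfinitePath 2 Λ)).Nonempty) :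
    (outerCylinder Q a ∩ outerCylinder Q b : Set (InfinitePath 2 Λ)) = outerCylinder Q b := by
  obtain ⟨ξ, h1, h2⟩ := h
  refine Set.inter_eq_right.2 fun ζ hζ t => ?_
  have h3 := h2 ⟨t, by omega⟩
  rw [h1 t] at h3
  rw [h3]
  exact hζ ⟨t, by omega⟩

theorem center_disjoint_outer (hΛ : IsLambda2N φ v Q) {n : ℕ} {a : Fin (n + 1) → Fin (2 * N)}
    {ξ : InfinitePath 2 Λ} (h1 : ξ.vertex 0 = v) (h2 : ξ ∈ outerCylinder Q a) : False :=
  hΛ.outer_ne_center _ ((outer_vertex_zero h2).symm.trans h1)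

theorem isPiSystem_cylinders (hΛ : IsLambda2N φ v Q) : IsPiSystem (cylinders v Q) := by
  rintro _ (⟨m, a, rfl⟩ | ⟨m, a, rfl⟩) _ (⟨n, b, rfl⟩ | ⟨n, b, rfl⟩) h
  · rcases le_total m n with hmn | hmn
    · exact Or.inl ⟨n, b, centerCylinder_inter hmn h⟩
    · rw [Set.inter_comm] at h ⊢
      exact Or.inl ⟨m, a, centerCylinder_inter hmn h⟩
  · obtain ⟨ξ, h1, h2⟩ := h
    exact (hΛ.center_disjoint_outer h1.1 h2).elim
  · obtain ⟨ξ, h1, h2⟩ := h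
    exact (hΛ.center_disjoint_outer h2.1 h1).elim
  · rcases le_total m n with hmn | hmn
    · exact Or.inr ⟨n, b, outerCylinder_inter hmn h⟩
    · rw [Set.inter_comm] at h ⊢
      exact Or.inr ⟨m, a, outerCylinder_inter hmn h⟩

/-- A word long enough for its degree to dominate `d(η)` fixes the segment of degree `d(η)`. Hence
each `Z(η)` is a countable union of coding cylinders. -/
theorem exists_cylinders_subset (hΛ : IsLambda2N φ v Q) {η : FinPath Λ} {ξ : InfinitePath 2 Λ}
    (hξ : ξ ∈ cylinder 2 η) : ∃ S ∈ cylinders v Q, ξ ∈ S ∧ S ⊆ cylinder 2 η := by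
  obtain ⟨n, hn⟩ := le_altDegree_two_mul (η.deg 2)
  rcases hΛ.exists_coding ξ with ⟨h0, a, ha⟩ | ⟨-, a, ha⟩
  · have hmem : ξ ∈ centerCylinder v Q (fun t : Fin (n + 1) => a t) := ⟨h0, fun t => ha t⟩
    refine ⟨_, Or.inl ⟨n, fun t => a t, rfl⟩, hmem, fun ζ hζ => ?_⟩
    have := seg_subpath (hΛ.seg_eq_of_mem_center hζ hmem) le_rfl (nat_zero_le_fun (η.deg 2))
      (hn.trans le_self_add)
    rwa [mem_cylinder_iff.1 hξ] at this
  · have hmem : ξ ∈ outerCylinder Q (fun t : Fin (n + 1) => a t) := fun t => ha t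
    refine ⟨_, Or.inr ⟨n, fun t => a t, rfl⟩, hmem, fun ζ hζ => ?_⟩
    have := seg_subpath (hΛ.seg_eq_of_mem_outer hζ hmem) le_rfl (nat_zero_le_fun (η.deg 2)) hn
    rwa [mem_cylinder_iff.1 hξ] at this

theorem generateFrom_cylinders (hΛ : IsLambda2N φ v Q) :
    (inferInstance : MeasurableSpace (InfinitePath 2 Λ)) =
      MeasurableSpace.generateFrom (cylinders v Q) := by
  refine le_antisymm ?_ (MeasurableSpace.generateFrom_le ?_)
  · rw [measurableSpace_eq_generateFrom]
    refine MeasurableSpace.generateFrom_le ?_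
    rintro _ ⟨η, rfl⟩
    have : cylinder 2 η = ⋃₀ {S | S ∈ cylinders v Q ∧ S ⊆ cylinder 2 η} := by
      refine Set.Subset.antisymm (fun ξ hξ => ?_) (Set.sUnion_subset fun S hS => hS.2)
      obtain ⟨S, h1, h2, h3⟩ := hΛ.exists_cylinders_subset hξ
      exact ⟨S, ⟨h1, h3⟩, h2⟩
    rw [this]
    exact MeasurableSet.sUnion (countable_cylinders.mono fun S hS => hS.1)
      fun S hS => MeasurableSpace.measurableSet_generateFrom hS.1
  · rintro _ (⟨n, a, rfl⟩ | ⟨n, a, rfl⟩)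
    exacts [hΛ.measurableSet_center a, hΛ.measurableSet_outer a]

theorem iUnion_cylinders (hΛ : IsLambda2N φ v Q) (n : ℕ) :
    ((⋃ a : Fin (n + 1) → Fin (2 * N), centerCylinder v Q a) ∪
      ⋃ a : Fin (n + 1) → Fin (2 * N), outerCylinder Q a) = (Set.univ : Set (InfinitePath 2 Λ)) := by
  refine Set.eq_univ_of_forall fun ξ => ?_
  rcases hΛ.exists_coding ξ with ⟨h0, a, ha⟩ | ⟨-, a, ha⟩
  · exact Or.inl (Set.mem_iUnion.2 ⟨fun t => a t, h0, fun t => ha t⟩)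
  · exact Or.inr (Set.mem_iUnion.2 ⟨fun t => a t, fun t => ha t⟩)

/-- Measures on the infinite path space that agree and are finite on the cylinders of the two copies
of the sequence space are equal. -/
theorem measure_ext (hΛ : IsLambda2N φ v Q) {μ ν : Measure (InfinitePath 2 Λ)}
    (hc : ∀ (n : ℕ) (a : Fin (n + 1) → Fin (2 * N)),
      μ (centerCylinder v Q a) = ν (centerCylinder v Q a))
    (ho : ∀ (n : ℕ) (a : Fin (n + 1) → Fin (2 * N)),
      μ (outerCylinder Q a) = ν (outerCylinder Q a))
    (hfin : ∀ S ∈ cylinders v Q, μ S ≠ ∞) : μ = ν := by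
  refine Measure.ext_of_generateFrom_of_cover_subset hΛ.generateFrom_cylinders
    hΛ.isPiSystem_cylinders subset_rfl countable_cylinders ?_ hfin ?_
  · rw [← Set.univ_subset_iff, ← hΛ.iUnion_cylinders 0]
    refine Set.union_subset (Set.iUnion_subset fun a => ?_) (Set.iUnion_subset fun a => ?_)
    · exact Set.subset_sUnion_of_mem (Or.inl ⟨0, a, rfl⟩)
    · exact Set.subset_sUnion_of_mem (Or.inr ⟨0, a, rfl⟩)
  · rintro _ (⟨n, a, rfl⟩ | ⟨n, a, rfl⟩)
    exacts [hc n a, ho n a]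

/-! ### The action of prefixing an edge on codings -/

theorem mem_cylinder_edge (hΛ : IsLambda2N φ v Q) {c : Fin 2 → ℕ}
    (hc : c ∈ ({blue, red} : Set _)) {a b : Λ} {f : a ⟶ b} (hf : KGraph.degree f = c)
    {ξ : InfinitePath 2 Λ} :
    ξ ∈ cylinder 2 (⟨a, b, f⟩ : FinPath Λ) ↔ ξ.vertex 0 = a ∧ ξ.vertex c = b := by
  rw [mem_cylinder_iff_of_deg (show FinPath.deg 2 ⟨a, b, f⟩ = c from hf)]
  refine ⟨fun h => ⟨congrArg FinPath.r h, congrArg FinPath.s h⟩, fun h => ?_⟩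
  exact hΛ.edge_unique hc (by rw [deg_seg, tsub_zero]) hf h.1 h.2

/-- Prefixing an edge from the center acts on the codings by a permutation of the alphabet. -/
theorem cylinder_inter_shift_outer (hΛ : IsLambda2N φ v Q) {c : Fin 2 → ℕ}
    (hc : c ∈ ({blue, red} : Set _)) {ψ : Equiv.Perm (Fin (2 * N))}
    (hψ : ∀ (ξ : InfinitePath 2 Λ) (p : Fin 2 → ℕ), ξ.vertex p = v → ∀ i,
        (ξ.vertex (p + red) = Q i ↔ ξ.vertex (p + c) = Q (ψ i)))
    {n : ℕ} (a : Fin (n + 1) → Fin (2 * N)) {f : v ⟶ Q (a 0)} (hf : KGraph.degree f = c) :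
    cylinder 2 ⟨v, Q (a 0), f⟩ ∩ shift c ⁻¹' outerCylinder Q a =
      centerCylinder v Q (fun t => ψ⁻¹ (a t)) := by
  ext ξ
  rw [Set.mem_inter_iff, hΛ.mem_cylinder_edge hc hf]
  have key : ∀ h : ξ.vertex 0 = v, ∀ t : Fin (n + 1),
      ξ.vertex ((t : ℕ) • (red + blue) + red) = Q (ψ⁻¹ (a t)) ↔
        ξ.vertex ((t : ℕ) • (red + blue) + c) = Q (a t) := fun h t => by
    rw [hψ ξ _ (hΛ.vertex_smul_of_center h t), show ψ (ψ⁻¹ (a t)) = a t from ψ.apply_symm_apply _]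
  constructor
  · rintro ⟨⟨h0, -⟩, h⟩
    exact ⟨h0, fun t => (key h0 t).2 (h t)⟩
  · rintro ⟨h0, h⟩
    refine ⟨⟨h0, ?_⟩, fun t => (key h0 t).1 (h t)⟩
    simpa using (key h0 0).1 (h 0)

/-- Prefixing an edge from an outer vertex adds a letter to the coding. -/
theorem cylinder_inter_shift_center (hΛ : IsLambda2N φ v Q) {c c' : Fin 2 → ℕ}
    (hc : c ∈ ({blue, red} : Set _)) (hcc : c + c' = red + blue) {ψ : Equiv.Perm (Fin (2 * N))}
    (hψ : ∀ (ξ : InfinitePath 2 Λ) (p : Fin 2 → ℕ), ξ.vertex p = v → ∀ i,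
        (ξ.vertex (p + red) = Q i ↔ ξ.vertex (p + c') = Q (ψ i)))
    {n : ℕ} (a : Fin (n + 1) → Fin (2 * N)) {i : Fin (2 * N)} {f : Q i ⟶ v}
    (hf : KGraph.degree f = c) :
    cylinder 2 ⟨Q i, v, f⟩ ∩ shift c ⁻¹' centerCylinder v Q a =
      outerCylinder Q (Fin.cons i (fun t => ψ (a t)) : Fin (n + 1 + 1) → Fin (2 * N)) := by
  ext ξ
  rw [Set.mem_inter_iff, hΛ.mem_cylinder_edge hc hf]
  -- Both sides look one edge ahead from the center at `t • (red + blue) + c`: the coding of the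
  -- tail along red, the coding of `ξ` at position `t + 1` along `c'`. This is why `ψ` belongs to
  -- the other color `c'`.
  have key : ∀ h : ξ.vertex 0 = Q i, ∀ t : Fin (n + 1),
      ξ.vertex ((t : ℕ) • (red + blue) + red + c) = Q (a t) ↔
        ξ.vertex (((t : ℕ) + 1) • (red + blue)) = Q (ψ (a t)) := fun h t => by
    rw [add_right_comm, hψ ξ _ (hΛ.vertex_smul_add_of_outer hc h t), add_assoc, hcc, succ_nsmul]
  constructor
  · rintro ⟨⟨h0, -⟩, h⟩ t
    refine Fin.cases ?_ (fun t => ?_) t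
    · simpa using h0
    · rw [Fin.cons_succ, Fin.val_succ, ← key h0]
      exact h.2 t
  · intro h
    have h0 : ξ.vertex 0 = Q i := outer_vertex_zero h
    have hv : ξ.vertex c = v := by simpa using hΛ.vertex_smul_add_of_outer hc h0 0
    refine ⟨⟨h0, hv⟩, ?_, fun t => ?_⟩
    · exact (congrArg ξ.vertex (zero_add c)).trans hv
    · have h1 := h t.succ
      rw [Fin.cons_succ, Fin.val_succ, ← key h0] at h1
      exact h1

end IsLambda2N

/-! ## Markov measures -/

/-- The Markov chain with initial state `i` that is driven by the transition choices `ω`. -/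
def drivenChain {ι : Type*} (i : ι) (ω : ℕ × ι → ι) : ℕ → ι
  | 0 => i
  | n + 1 => ω (n, drivenChain i ω n)

theorem measurable_drivenChain {ι : Type*} [Fintype ι] [MeasurableSpace ι]
    [MeasurableSingletonClass ι] (i : ι) : Measurable (drivenChain i) := by
  refine measurable_pi_iff.2 fun n => ?_
  induction n with
  | zero => exact measurable_const
  | succ n ih =>
    refine measurable_to_countable' fun j => ?_
    have : (fun ω : ℕ × ι → ι => drivenChain i ω (n + 1)) ⁻¹' {j} =
        ⋃ l, (fun ω => drivenChain i ω n) ⁻¹' {l} ∩ (fun ω => ω (n, l)) ⁻¹' {j} := by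
      ext ω
      simp [drivenChain]
    rw [this]
    exact MeasurableSet.iUnion fun l => (ih (measurableSet_singleton l)).inter
      (measurable_pi_apply (n, l) (measurableSet_singleton j))

/-- Following a word becomes a condition on the coordinates `(t, a t)` of `ω`, which are distinct
and hence independent under a product measure. -/
theorem drivenChain_eq_iff {ι : Type*} (ω : ℕ × ι → ι) (a : ℕ → ι) (n : ℕ) :
    (∀ t ≤ n, drivenChain (a 0) ω t = a t) ↔ ∀ t < n, ω (t, a t) = a (t + 1) := by
  constructor
  · intro h t ht
    rw [← h t ht.le]
    exact h (t + 1) ht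
  · intro h t ht
    induction t with
    | zero => rfl
    | succ t ih => rw [drivenChain, ih (by omega), h t (by omega)]

/-- The Markov measure on sequences with transition matrix `T` and counting initial distribution. -/
theorem exists_markov_sequence_measure {ι : Type*} [Fintype ι] [MeasurableSpace ι]
    [MeasurableSingletonClass ι] (T : Matrix ι ι ℝ) (hT : ∀ i j, 0 ≤ T i j)
    (hsum : ∀ i, ∑ j, T i j = 1) :
    ∃ κ : Measure (ℕ → ι), ∀ (n : ℕ) (a : Fin (n + 1) → ι),
      κ {s | ∀ t : Fin (n + 1), s t = a t} =
        ENNReal.ofReal (∏ t : Fin n, T (a t.castSucc) (a t.succ)) := by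
  classical
  let ν : ι → Measure ι := fun i => ∑ j, ENNReal.ofReal (T i j) • Measure.dirac j
  have hν : ∀ i j, ν i {j} = ENNReal.ofReal (T i j) := fun i j => by
    simp only [ν, Measure.finsetSum_apply, Measure.smul_apply, smul_eq_mul]
    rw [Finset.sum_eq_single j]
    · simp
    · intro l _ hl
      simp [hl]
    · simp
  have hprob : ∀ i, IsProbabilityMeasure (ν i) := fun i => ⟨by
    simp only [ν, Measure.finsetSum_apply, Measure.smul_apply, smul_eq_mul, measure_univ, mul_one]
    rw [← ENNReal.ofReal_sum_of_nonneg fun j _ => hT i j, hsum, ENNReal.ofReal_one]⟩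
  -- One independent choice of a successor for every time and every state.
  let P : Measure (ℕ × ι → ι) := Measure.infinitePi fun p => ν p.2
  -- Each initial state carries mass one, as the empty product for `n = 0` demands; only the chain
  -- started at `a 0` contributes.
  refine ⟨∑ i, P.map (drivenChain i), fun n a => ?_⟩
  have hm : MeasurableSet {s : ℕ → ι | ∀ t : Fin (n + 1), s t = a t} := by
    have : {s : ℕ → ι | ∀ t : Fin (n + 1), s t = a t} =
        ⋂ t : Fin (n + 1), (fun s : ℕ → ι => s t) ⁻¹' {a t} := by
      ext s; simp
    rw [this]
    exact MeasurableSet.iInter fun t => measurable_pi_apply _ (measurableSet_singleton _)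
  rw [Measure.finsetSum_apply, Finset.sum_eq_single (a 0)]
  · rw [Measure.map_apply (measurable_drivenChain _) hm]
    let b : ℕ → ι := fun t => a ⟨min t n, by omega⟩
    have hb : ∀ t : Fin (n + 1), b t = a t := fun t => by
      simp only [b]
      congr 1
      ext
      simp
      omega
    let s : Finset (ℕ × ι) := (Finset.range n).image fun t => (t, b t)
    have : drivenChain (a 0) ⁻¹' {s | ∀ t : Fin (n + 1), s t = a t} =
        Set.pi s fun p => {b (p.1 + 1)} := by
      ext ω
      have h1 := drivenChain_eq_iff ω b n
      rw [show b 0 = a 0 from hb 0] at h1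
      simp only [Set.mem_preimage, Set.mem_ofPred_eq, Set.mem_pi, s, Finset.coe_image,
        Set.forall_mem_image, Finset.coe_range, Set.mem_Iio, Set.mem_singleton_iff]
      rw [← h1]
      constructor
      · intro h t ht
        exact (h ⟨t, by omega⟩).trans (hb ⟨t, by omega⟩).symm
      · intro h t
        rw [h t (by omega), hb]
    rw [this, Measure.infinitePi_pi _ fun _ _ => measurableSet_singleton _,
      Finset.prod_image fun x _ y _ h => congrArg Prod.fst h, Finset.prod_range,
      ENNReal.ofReal_prod_of_nonneg fun _ _ => hT _ _]
    refine Finset.prod_congr rfl fun t _ => ?_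
    rw [hν]
    congr 2
    · exact hb t.castSucc
    · exact hb t.succ
  · intro i _ hi
    rw [Measure.map_apply (measurable_drivenChain _) hm]
    convert measure_empty (μ := P)
    refine Set.eq_empty_of_forall_notMem fun ω hω => hi ?_
    exact hω 0
  · simp

/-- The measure on `Λ_{2N}^∞` that is `α` times the Markov measure of `T` on the first copy of the
sequence space and `β` times the Markov measure on the second copy. -/
structure IsWeightedMarkovMeasure {N : ℕ} {Λ : Type u} [Category.{w} Λ] [KGraph 2 Λ] (v : Λ)
    (Q : Fin (2 * N) → Λ) (T : Matrix (Fin (2 * N)) (Fin (2 * N)) ℝ) (α β : ℝ≥0∞)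
    (μ : Measure (InfinitePath 2 Λ)) : Prop where
  center : ∀ (n : ℕ) (a : Fin (n + 1) → Fin (2 * N)),
    μ (centerCylinder v Q a) = α * ENNReal.ofReal (∏ t : Fin n, T (a t.castSucc) (a t.succ))
  outer : ∀ (n : ℕ) (a : Fin (n + 1) → Fin (2 * N)),
    μ (outerCylinder Q a) = β * ENNReal.ofReal (∏ t : Fin n, T (a t.castSucc) (a t.succ))

theorem IsMarkovMeasure.isWeightedMarkovMeasure {N : ℕ} {Λ : Type u} [Category.{w} Λ]
    [KGraph 2 Λ] {v : Λ} {Q : Fin (2 * N) → Λ} {T : Matrix (Fin (2 * N)) (Fin (2 * N)) ℝ}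
    {μ : Measure (InfinitePath 2 Λ)} (h : IsMarkovMeasure v Q T μ) :
    IsWeightedMarkovMeasure v Q T 1 1 μ :=
  ⟨fun n a => by rw [h.center, one_mul], fun n a => by rw [h.outer, one_mul]⟩

/-! ### Weighted Markov measures: uniqueness, existence, quasi-invariance -/

namespace IsLambda2N

variable {N : ℕ} {φ : Equiv.Perm (Fin (2 * N))} {Λ : Type u} [Category.{w} Λ] [KGraph 2 Λ]
  {v : Λ} {Q : Fin (2 * N) → Λ} {T : Matrix (Fin (2 * N)) (Fin (2 * N)) ℝ} {α β : ℝ≥0∞}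
  {μ ν : Measure (InfinitePath 2 Λ)}

theorem weightedMarkov_ne_top (h : IsWeightedMarkovMeasure v Q T α β μ) (hα : α ≠ ∞)
    (hβ : β ≠ ∞) : ∀ S ∈ cylinders v Q, μ S ≠ ∞ := by
  rintro _ (⟨n, a, rfl⟩ | ⟨n, a, rfl⟩)
  · rw [h.center]
    exact ENNReal.mul_ne_top hα ENNReal.ofReal_ne_top
  · rw [h.outer]
    exact ENNReal.mul_ne_top hβ ENNReal.ofReal_ne_top

theorem weightedMarkov_unique (hΛ : IsLambda2N φ v Q) (h : IsWeightedMarkovMeasure v Q T α β μ)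
    (h' : IsWeightedMarkovMeasure v Q T α β ν) (hα : α ≠ ∞) (hβ : β ≠ ∞) : μ = ν :=
  hΛ.measure_ext (fun n a => by rw [h.center, h'.center]) (fun n a => by rw [h.outer, h'.outer])
    (weightedMarkov_ne_top h hα hβ)

theorem weightedMarkov_isFiniteMeasure (hΛ : IsLambda2N φ v Q)
    (h : IsWeightedMarkovMeasure v Q T α β μ) (hα : α ≠ ∞) (hβ : β ≠ ∞) : IsFiniteMeasure μ := by
  refine ⟨?_⟩
  rw [← hΛ.iUnion_cylinders 0]
  refine (measure_union_le _ _).trans_lt (ENNReal.add_lt_top.2 ⟨?_, ?_⟩)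
  · refine (measure_iUnion_fintype_le _ _).trans_lt (ENNReal.sum_lt_top.2 fun a _ => ?_)
    exact (weightedMarkov_ne_top h hα hβ _ (Or.inl ⟨0, a, rfl⟩)).lt_top
  · refine (measure_iUnion_fintype_le _ _).trans_lt (ENNReal.sum_lt_top.2 fun a _ => ?_)
    exact (weightedMarkov_ne_top h hα hβ _ (Or.inr ⟨0, a, rfl⟩)).lt_top

/-- The sequence measure is pushed forward along sections `C` and `O` of the codings. A cylinder of
either copy pulls back to its word cylinder under its own section and to the empty set under the
other. -/
theorem exists_weightedMarkov (hΛ : IsLambda2N φ v Q) (hT : ∀ i j, 0 ≤ T i j)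
    (hsum : ∀ i, ∑ j, T i j = 1) (α β : ℝ≥0∞) :
    ∃ μ : Measure (InfinitePath 2 Λ), IsWeightedMarkovMeasure v Q T α β μ := by
  obtain ⟨κ, hκ⟩ := exists_markov_sequence_measure T hT hsum
  choose C hC0 hC using hΛ.exists_center
  choose O hO using hΛ.exists_outer
  have hCc : ∀ {n} (a : Fin (n + 1) → Fin (2 * N)),
      C ⁻¹' centerCylinder v Q a = {s | ∀ t : Fin (n + 1), s t = a t} := fun a => by
    ext s
    refine ⟨fun h t => ?_, fun h => ⟨hC0 s, fun t => by rw [hC, h]⟩⟩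
    exact hΛ.outer_injective ((hC s t).symm.trans (h.2 t))
  have hCo : ∀ {n} (a : Fin (n + 1) → Fin (2 * N)), C ⁻¹' outerCylinder Q a = ∅ := fun a =>
    Set.eq_empty_of_forall_notMem fun s hs => hΛ.center_disjoint_outer (hC0 s) hs
  have hOo : ∀ {n} (a : Fin (n + 1) → Fin (2 * N)),
      O ⁻¹' outerCylinder Q a = {s | ∀ t : Fin (n + 1), s t = a t} := fun a => by
    ext s
    refine ⟨fun h t => ?_, fun h t => by rw [hO, h]⟩
    exact hΛ.outer_injective ((hO s t).symm.trans (h t))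
  have hOc : ∀ {n} (a : Fin (n + 1) → Fin (2 * N)), O ⁻¹' centerCylinder v Q a = ∅ := fun a =>
    Set.eq_empty_of_forall_notMem fun s hs =>
      hΛ.outer_ne_center (s 0) (((hO s 0).symm.trans (by rw [zero_smul])).trans hs.1)
  have hm : ∀ {n} (a : Fin (n + 1) → Fin (2 * N)),
      MeasurableSet {s : ℕ → Fin (2 * N) | ∀ t : Fin (n + 1), s t = a t} := fun {n} a => by
    have : {s : ℕ → Fin (2 * N) | ∀ t : Fin (n + 1), s t = a t} =
        ⋂ t : Fin (n + 1), (fun s : ℕ → Fin (2 * N) => s t) ⁻¹' {a t} := by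
      ext s; simp
    rw [this]
    exact MeasurableSet.iInter fun t => measurable_pi_apply _ (measurableSet_singleton _)
  have hCm : Measurable C := by
    change @Measurable _ _ _ (inferInstance : MeasurableSpace (InfinitePath 2 Λ)) C
    rw [hΛ.generateFrom_cylinders]
    refine measurable_generateFrom ?_
    rintro _ (⟨n, a, rfl⟩ | ⟨n, a, rfl⟩)
    · rw [hCc]; exact hm a
    · rw [hCo]; exact MeasurableSet.empty
  have hOm : Measurable O := by
    change @Measurable _ _ _ (inferInstance : MeasurableSpace (InfinitePath 2 Λ)) O
    rw [hΛ.generateFrom_cylinders]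
    refine measurable_generateFrom ?_
    rintro _ (⟨n, a, rfl⟩ | ⟨n, a, rfl⟩)
    · rw [hOc]; exact MeasurableSet.empty
    · rw [hOo]; exact hm a
  refine ⟨α • κ.map C + β • κ.map O, fun n a => ?_, fun n a => ?_⟩
  · rw [Measure.add_apply, Measure.smul_apply, Measure.smul_apply,
      Measure.map_apply hCm (hΛ.measurableSet_center a),
      Measure.map_apply hOm (hΛ.measurableSet_center a), hCc, hOc, measure_empty, hκ]
    simp
  · rw [Measure.add_apply, Measure.smul_apply, Measure.smul_apply,
      Measure.map_apply hCm (hΛ.measurableSet_outer a),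
      Measure.map_apply hOm (hΛ.measurableSet_outer a), hCo, hOo, measure_empty, hκ]
    simp

theorem cylinder_edge_inter_shift_center (hΛ : IsLambda2N φ v Q) {c : Fin 2 → ℕ}
    (hc : c ∈ ({blue, red} : Set _)) {i : Fin (2 * N)} {f : v ⟶ Q i} (hf : KGraph.degree f = c)
    {n : ℕ} (a : Fin (n + 1) → Fin (2 * N)) :
    cylinder 2 ⟨v, Q i, f⟩ ∩ shift c ⁻¹' centerCylinder v Q a = ∅ := by
  refine Set.eq_empty_of_forall_notMem fun ξ hξ => hΛ.outer_ne_center i ?_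
  rw [← ((hΛ.mem_cylinder_edge hc hf).1 hξ.1).2]
  exact (congrArg ξ.vertex (zero_add c)).symm.trans hξ.2.1

theorem cylinder_edge_inter_shift_outer (hΛ : IsLambda2N φ v Q) {c : Fin 2 → ℕ}
    (hc : c ∈ ({blue, red} : Set _)) {i : Fin (2 * N)} {f : Q i ⟶ v} (hf : KGraph.degree f = c)
    {n : ℕ} (a : Fin (n + 1) → Fin (2 * N)) :
    cylinder 2 ⟨Q i, v, f⟩ ∩ shift c ⁻¹' outerCylinder Q a = ∅ := by
  refine Set.eq_empty_of_forall_notMem fun ξ hξ => ?_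
  refine hΛ.center_disjoint_outer ?_ hξ.2
  rw [← ((hΛ.mem_cylinder_edge hc hf).1 hξ.1).2]
  exact congrArg ξ.vertex (zero_add c)

theorem map_shift_apply {S : Set (InfinitePath 2 Λ)} {c : Fin 2 → ℕ}
    {E : Set (InfinitePath 2 Λ)} (hE : MeasurableSet E) :
    (μ.restrict S).map (shift c) E = μ (S ∩ shift c ⁻¹' E) := by
  rw [Measure.map_apply (measurable_shift _) hE, Measure.restrict_apply (measurable_shift _ hE),
    Set.inter_comm]

/-- The effect on a weighted Markov measure of prefixing an edge from the center. -/
theorem measure_prefix_center (hΛ : IsLambda2N φ v Q) (hT : ∀ i j, T (φ i) (φ j) = T i j)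
    (h : IsWeightedMarkovMeasure v Q T α β μ) (hα : α ≠ ∞) (hβ : β ≠ ∞) {c : Fin 2 → ℕ}
    (hc : c ∈ ({blue, red} : Set _)) {i : Fin (2 * N)} {f : v ⟶ Q i} (hf : KGraph.degree f = c)
    {E : Set (InfinitePath 2 Λ)} (hE : MeasurableSet E) :
    β * μ (cylinder 2 ⟨v, Q i, f⟩ ∩ shift c ⁻¹' E) =
      α * μ (cylinder 2 (FinPath.ofVertex (Q i)) ∩ E) := by
  have hfin := hΛ.weightedMarkov_isFiniteMeasure h hα hβ
  obtain ⟨ψ, hψ', hψ⟩ := hΛ.exists_vertex_color_iff hc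
  have hTψ : ∀ i j, T (ψ⁻¹ i) (ψ⁻¹ j) = T i j := by
    rcases hψ' with rfl | rfl
    · intro i j; simp
    · intro i j
      rw [← hT (ψ⁻¹ i)]
      exact congrArg₂ T (ψ.apply_symm_apply i) (ψ.apply_symm_apply j)
  -- Both sides are finite measures in `E`, so coding cylinders suffice. Prefixing moves an outer
  -- cylinder, of weight `β`, to a center cylinder, of weight `α`, and the outside factors balance
  -- this.
  suffices hs : β • (μ.restrict (cylinder 2 ⟨v, Q i, f⟩)).map (shift c) =
      α • μ.restrict (cylinder 2 (FinPath.ofVertex (Q i))) by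
    have := congrArg (fun m : Measure (InfinitePath 2 Λ) => m E) hs
    simp only [Measure.smul_apply, smul_eq_mul, map_shift_apply hE,
      Measure.restrict_apply hE] at this
    rwa [Set.inter_comm E] at this
  refine hΛ.measure_ext (fun n a => ?_) (fun n a => ?_) (fun S hS => ?_)
  · rw [Measure.smul_apply, Measure.smul_apply, map_shift_apply (hΛ.measurableSet_center a),
      hΛ.cylinder_edge_inter_shift_center hc hf,
      Measure.restrict_apply (hΛ.measurableSet_center a)]
    have : centerCylinder v Q a ∩ cylinder 2 (FinPath.ofVertex (Q i)) = ∅ :=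
      Set.eq_empty_of_forall_notMem fun ξ hξ => hΛ.outer_ne_center i
        ((mem_cylinder_ofVertex.1 hξ.2).symm.trans hξ.1.1)
    rw [this]
    simp
  · rw [Measure.smul_apply, Measure.smul_apply, map_shift_apply (hΛ.measurableSet_outer a),
      Measure.restrict_apply (hΛ.measurableSet_outer a)]
    by_cases hi : a 0 = i
    · subst hi
      have : outerCylinder Q a ∩ cylinder 2 (FinPath.ofVertex (Q (a 0))) = outerCylinder Q a :=
        Set.inter_eq_left.2 fun ξ hξ => mem_cylinder_ofVertex.2 (outer_vertex_zero hξ)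
      rw [this, hΛ.cylinder_inter_shift_outer hc hψ a hf, h.center, h.outer]
      simp only [smul_eq_mul, hTψ]
      ring
    · have h1 : outerCylinder Q a ∩ cylinder 2 (FinPath.ofVertex (Q i)) = ∅ :=
        Set.eq_empty_of_forall_notMem fun ξ hξ => hi (hΛ.outer_injective
          ((outer_vertex_zero hξ.1).symm.trans (mem_cylinder_ofVertex.1 hξ.2)))
      have h2 : cylinder 2 ⟨v, Q i, f⟩ ∩ shift c ⁻¹' outerCylinder Q a = ∅ :=
        Set.eq_empty_of_forall_notMem fun ξ hξ => hi (hΛ.outer_injective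
          ((outer_vertex_zero hξ.2).symm.trans ((congrArg ξ.vertex (zero_add c)).trans
            ((hΛ.mem_cylinder_edge hc hf).1 hξ.1).2)))
      rw [h1, h2]
      simp
  · exact ENNReal.mul_ne_top hβ (measure_ne_top _ _)

theorem exists_other_color {c : Fin 2 → ℕ} (hc : c ∈ ({blue, red} : Set _)) :
    ∃ c' ∈ ({blue, red} : Set (Fin 2 → ℕ)), c + c' = red + blue := by
  rcases hc with rfl | rfl
  exacts [⟨red, red_mem, add_comm _ _⟩, ⟨blue, blue_mem, rfl⟩]

/-- The effect on a weighted Markov measure of prefixing an edge from an outer vertex. -/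
theorem measure_prefix_outer (hΛ : IsLambda2N φ v Q) (hT0 : ∀ i j, 0 ≤ T i j)
    (hT : ∀ i j, T (φ i) (φ j) = T i j)
    (h : IsWeightedMarkovMeasure v Q T α β μ) (hα : α ≠ ∞) (hβ : β ≠ ∞) {c : Fin 2 → ℕ}
    (hc : c ∈ ({blue, red} : Set _)) {i : Fin (2 * N)} {f : Q i ⟶ v} (hf : KGraph.degree f = c) :
    ∃ ψ : Equiv.Perm (Fin (2 * N)), ∀ E : Set (InfinitePath 2 Λ), MeasurableSet E →
      α * μ (cylinder 2 ⟨Q i, v, f⟩ ∩ shift c ⁻¹' E) =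
        ∑ j, β * ENNReal.ofReal (T i (ψ j)) * μ (centerCylinder v Q ![j] ∩ E) := by
  have hfin := hΛ.weightedMarkov_isFiniteMeasure h hα hβ
  obtain ⟨c', hc', hcc⟩ := exists_other_color hc
  obtain ⟨ψ, hψ', hψ⟩ := hΛ.exists_vertex_color_iff hc'
  have hTψ : ∀ i j, T (ψ i) (ψ j) = T i j := by
    rcases hψ' with rfl | rfl
    · intro i j; rfl
    · exact hT
  refine ⟨ψ, fun E hE => ?_⟩
  -- Prefixing the letter `i` adds the factor `T i (ψ (a 0))` to the path product, so the density
  -- depends only on the first letter.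
  suffices hs : α • (μ.restrict (cylinder 2 ⟨Q i, v, f⟩)).map (shift c) =
      ∑ j, (β * ENNReal.ofReal (T i (ψ j))) • μ.restrict (centerCylinder v Q ![j]) by
    have := congrArg (fun m : Measure (InfinitePath 2 Λ) => m E) hs
    simp only [Measure.smul_apply, smul_eq_mul, map_shift_apply hE,
      Measure.restrict_apply hE, Measure.finsetSum_apply] at this
    rw [this]
    exact Finset.sum_congr rfl fun j _ => by rw [Set.inter_comm E]
  refine hΛ.measure_ext (fun n a => ?_) (fun n a => ?_) (fun S hS => ?_)
  · rw [Measure.smul_apply, map_shift_apply (hΛ.measurableSet_center a),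
      hΛ.cylinder_inter_shift_center hc hcc hψ a hf, h.outer, Measure.finsetSum_apply,
      Finset.sum_eq_single (a 0)]
    · rw [Measure.smul_apply, Measure.restrict_apply (hΛ.measurableSet_center a),
        Set.inter_eq_left.2, h.center, Fin.prod_univ_succ]
      · simp only [smul_eq_mul, Fin.castSucc_zero, Fin.cons_zero, Fin.cons_succ,
          ← Fin.succ_castSucc, hTψ]
        rw [ENNReal.ofReal_mul (hT0 _ _)]
        ring
      · rintro ξ hξ
        refine ⟨hξ.1, fun t => ?_⟩
        obtain rfl : t = 0 := Fin.eq_zero t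
        exact hξ.2 0
    · intro j _ hj
      rw [Measure.smul_apply, Measure.restrict_apply (hΛ.measurableSet_center a)]
      have : centerCylinder v Q a ∩ centerCylinder v Q ![j] = ∅ :=
        Set.eq_empty_of_forall_notMem fun ξ hξ => hj (hΛ.outer_injective
          ((hξ.2.2 0).symm.trans (hξ.1.2 0)))
      rw [this]
      simp
    · simp
  · rw [Measure.smul_apply, map_shift_apply (hΛ.measurableSet_outer a),
      hΛ.cylinder_edge_inter_shift_outer hc hf, Measure.finsetSum_apply, measure_empty, smul_zero]
    refine (Finset.sum_eq_zero fun j _ => ?_).symm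
    rw [Measure.smul_apply, Measure.restrict_apply (hΛ.measurableSet_outer a)]
    have : outerCylinder Q a ∩ centerCylinder v Q ![j] = ∅ :=
      Set.eq_empty_of_forall_notMem fun ξ hξ => hΛ.center_disjoint_outer hξ.2.1 hξ.1
    rw [this]
    simp
  · exact ENNReal.mul_ne_top hα (measure_ne_top _ _)

theorem iUnion_centerCylinder (hΛ : IsLambda2N φ v Q) :
    ⋃ j, centerCylinder v Q ![j] = cylinder 2 (FinPath.ofVertex v) := by
  ext ξ
  rw [mem_cylinder_ofVertex, Set.mem_iUnion]
  refine ⟨fun ⟨j, hj⟩ => hj.1, fun h => ?_⟩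
  obtain ⟨j, hj⟩ := hΛ.vertex_of_center red_mem h
  refine ⟨j, h, fun t => ?_⟩
  obtain rfl : t = 0 := Fin.eq_zero t
  simpa using hj

theorem outerCylinder_one (j : Fin (2 * N)) :
    outerCylinder Q ![j] = cylinder 2 (FinPath.ofVertex (Q j)) := by
  ext ξ
  rw [mem_cylinder_ofVertex]
  refine ⟨fun h => outer_vertex_zero h, fun h t => ?_⟩
  obtain rfl : t = 0 := Fin.eq_zero t
  simpa using h

theorem measure_center_inter (hΛ : IsLambda2N φ v Q) (E : Set (InfinitePath 2 Λ))
    (hE : MeasurableSet E) :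
    μ (cylinder 2 (FinPath.ofVertex v) ∩ E) = ∑ j, μ (centerCylinder v Q ![j] ∩ E) := by
  rw [← hΛ.iUnion_centerCylinder, Set.iUnion_inter, measure_iUnion, tsum_fintype]
  · intro i j hij
    refine Set.disjoint_left.2 fun ξ h1 h2 => hij (hΛ.outer_injective ?_)
    exact (h1.1.2 0).symm.trans (h2.1.2 0)
  · exact fun j => (hΛ.measurableSet_center _).inter hE

theorem single_mem (i : Fin 2) : (Pi.single i 1 : Fin 2 → ℕ) ∈ ({blue, red} : Set _) := by
  fin_cases i
  exacts [Or.inl rfl, Or.inr rfl]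

theorem cylinder_comp_inter_shift {a b d : Λ} (e : a ⟶ b) (ν : b ⟶ d)
    (E : Set (InfinitePath 2 Λ)) :
    cylinder 2 ⟨a, d, e ≫ ν⟩ ∩ shift (FinPath.deg 2 ⟨a, d, e ≫ ν⟩) ⁻¹' E =
      cylinder 2 ⟨a, b, e⟩ ∩ shift (FinPath.deg 2 ⟨a, b, e⟩) ⁻¹'
        (cylinder 2 ⟨b, d, ν⟩ ∩ shift (FinPath.deg 2 ⟨b, d, ν⟩) ⁻¹' E) := by
  rw [cylinder_comp, deg_comp, Set.inter_assoc, Set.preimage_inter]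
  congr 2
  ext ξ
  rw [Set.mem_preimage, Set.mem_preimage, Set.mem_preimage, shift_shift, add_comm]

theorem cylinder_subset_source {b d : Λ} (ν : b ⟶ d) :
    cylinder 2 ⟨b, d, ν⟩ ⊆ cylinder 2 (FinPath.ofVertex b) :=
  fun _ h => mem_cylinder_ofVertex.2 (vertex_zero_of_mem h)

/-- Induction reduces this to edges. An edge from the center preserves the measure; one from an
outer vertex has on each `centerCylinder v Q ![j]` a constant positive density. -/
theorem markov_quasiInvariant (hΛ : IsLambda2N φ v Q) (hT0 : ∀ i j, 0 < T i j)
    (hT : ∀ i j, T (φ i) (φ j) = T i j) (h : IsWeightedMarkovMeasure v Q T 1 1 μ)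
    (η : FinPath Λ) : ∀ E : Set (InfinitePath 2 Λ), MeasurableSet E →
      (μ (cylinder 2 η ∩ shift (η.deg 2) ⁻¹' E) = 0 ↔
        μ (cylinder 2 (FinPath.ofVertex η.s) ∩ E) = 0) := by
  have key : ∀ {a b : Λ} (e : a ⟶ b) (i : Fin 2), KGraph.degree e = (Pi.single i 1 : Fin 2 → ℕ) →
      ∀ E : Set (InfinitePath 2 Λ), MeasurableSet E →
      (μ (cylinder 2 ⟨a, b, e⟩ ∩ shift (Pi.single i 1) ⁻¹' E) = 0 ↔
        μ (cylinder 2 (FinPath.ofVertex b) ∩ E) = 0) := by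
    intro a b e i he E hE
    rcases hΛ.edge_ends (single_mem i) e he with ⟨rfl, j, rfl⟩ | ⟨⟨j, rfl⟩, rfl⟩
    · have := hΛ.measure_prefix_center hT h ENNReal.one_ne_top ENNReal.one_ne_top (single_mem i)
        he hE
      rw [one_mul, one_mul] at this
      rw [this]
    · obtain ⟨ψ, hψ⟩ := hΛ.measure_prefix_outer (fun i j => (hT0 i j).le) hT h ENNReal.one_ne_top
        ENNReal.one_ne_top (single_mem i) he
      have := hψ E hE
      rw [one_mul] at this
      rw [this, hΛ.measure_center_inter E hE, Finset.sum_eq_zero_iff, Finset.sum_eq_zero_iff]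
      refine forall₂_congr fun l _ => ?_
      rw [one_mul, mul_eq_zero, ENNReal.ofReal_eq_zero, or_iff_right (not_le.2 (hT0 _ _))]
  refine FinPath.edge_induction 2 (P := fun η => ∀ E : Set (InfinitePath 2 Λ), MeasurableSet E →
      (μ (cylinder 2 η ∩ shift (η.deg 2) ⁻¹' E) = 0 ↔
        μ (cylinder 2 (FinPath.ofVertex η.s) ∩ E) = 0)) (fun a E hE => ?_) (fun {a b d} e ν i he ih E hE => ?_) η
  · rw [deg_ofVertex, show shift 0 ⁻¹' E = E from Set.ext fun ξ => by
      rw [Set.mem_preimage, shift_zero]]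
    rfl
  · have hm : MeasurableSet (cylinder 2 ⟨b, d, ν⟩ ∩ shift (FinPath.deg 2 ⟨b, d, ν⟩) ⁻¹' E) :=
      (measurableSet_cylinder _).inter (measurable_shift _ hE)
    rw [cylinder_comp_inter_shift, show FinPath.deg 2 ⟨a, b, e⟩ = Pi.single i 1 from he,
      key e i he _ hm, Set.inter_eq_right.2
        (Set.inter_subset_left.trans (cylinder_subset_source ν)), ih E hE]

theorem measure_cylinder_of_edges {r : ℝ≥0∞}
    (hr : ∀ {a b : Λ} (e : a ⟶ b) (i : Fin 2), KGraph.degree e = (Pi.single i 1 : Fin 2 → ℕ) →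
      ∀ E : Set (InfinitePath 2 Λ), MeasurableSet E →
      μ (cylinder 2 ⟨a, b, e⟩ ∩ shift (Pi.single i 1) ⁻¹' E) =
        r * μ (cylinder 2 (FinPath.ofVertex b) ∩ E)) (η : FinPath Λ) :
    μ (cylinder 2 η) = r ^ (∑ i, η.deg 2 i) * μ (cylinder 2 (FinPath.ofVertex η.s)) := by
  refine FinPath.edge_induction 2 (P := fun η => μ (cylinder 2 η) =
    r ^ (∑ i, η.deg 2 i) * μ (cylinder 2 (FinPath.ofVertex η.s))) (fun a => ?_) (fun {a b d} e ν i he ih => ?_) η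
  · rw [deg_ofVertex]
    simp [FinPath.ofVertex]
  · have he' : FinPath.deg 2 ⟨a, b, e⟩ = Pi.single i 1 := he
    rw [cylinder_comp, deg_comp, he', hr e i he _ (measurableSet_cylinder _),
      Set.inter_eq_right.2 (cylinder_subset_source ν), ih]
    simp only [Pi.add_apply, Finset.sum_add_distrib, Finset.sum_pi_single', Finset.mem_univ,
      if_true]
    rw [pow_add, pow_one, mul_assoc]

/-- For a constant transition matrix the density is constant too. An edge from the center scales by
`α / β` and one from an outer vertex by `u * β / α`; both equal `r` exactly when `α = r * β` and `u
= r * r`. -/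
theorem uniform_prefix (hΛ : IsLambda2N φ v Q) {u : ℝ} (hu : 0 ≤ u) {r : ℝ≥0∞}
    (h : IsWeightedMarkovMeasure v Q (fun _ _ => u) α β μ) (hα : α ≠ ∞) (hβ : β ≠ ∞)
    (hr0 : r ≠ 0) (hrt : r ≠ ∞) (hβ0 : β ≠ 0) (hαβ : α = r * β)
    (hur : ENNReal.ofReal u = r * r) {a b : Λ} (e : a ⟶ b) (i : Fin 2)
    (he : KGraph.degree e = (Pi.single i 1 : Fin 2 → ℕ)) (E : Set (InfinitePath 2 Λ))
    (hE : MeasurableSet E) :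
    μ (cylinder 2 ⟨a, b, e⟩ ∩ shift (Pi.single i 1) ⁻¹' E) =
      r * μ (cylinder 2 (FinPath.ofVertex b) ∩ E) := by
  rcases hΛ.edge_ends (single_mem i) e he with ⟨rfl, j, rfl⟩ | ⟨⟨j, rfl⟩, rfl⟩
  · have := hΛ.measure_prefix_center (fun _ _ => rfl) h hα hβ (single_mem i) he hE
    rw [hαβ, mul_comm r, mul_assoc] at this
    exact (ENNReal.mul_right_inj hβ0 hβ).1 this
  · obtain ⟨ψ, hψ⟩ := hΛ.measure_prefix_outer (fun i j => hu) (fun _ _ => rfl) h hα hβ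
      (single_mem i) he
    have := hψ E hE
    rw [← Finset.mul_sum, ← hΛ.measure_center_inter E hE, hur, hαβ] at this
    refine (ENNReal.mul_right_inj (mul_ne_zero hr0 hβ0) (ENNReal.mul_ne_top hrt hβ)).1 ?_
    rw [this]
    ring

end IsLambda2N

/-! ## The Perron–Frobenius measure of `Λ_{2N}` -/

theorem Matrix.mem_spectrum_iff_exists_mulVec {ι K : Type*} [Fintype ι] [DecidableEq ι] [Field K]
    (A : Matrix ι ι K) (z : K) :
    z ∈ spectrum K A ↔ ∃ x : ι → K, x ≠ 0 ∧ A.mulVec x = z • x := by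
  rw [← Matrix.spectrum_toLin', ← Module.End.hasEigenvalue_iff_mem_spectrum]
  constructor
  · intro h
    obtain ⟨x, hx⟩ := h.exists_hasEigenvector
    exact ⟨x, hx.2, by simpa using hx.apply_eq_smul⟩
  · rintro ⟨x, hx, h⟩
    exact Module.End.hasEigenvalue_of_hasEigenvector
      (Module.End.hasEigenvector_iff.2 ⟨Module.End.mem_eigenspace_iff.2 (by simpa using h), hx⟩)

namespace IsLambda2N

variable {N : ℕ} {φ : Equiv.Perm (Fin (2 * N))} {Λ : Type u} [Category.{w} Λ] [KGraph 2 Λ]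
  {v : Λ} {Q : Fin (2 * N) → Λ}

theorem vertexMatrix_center_outer (hΛ : IsLambda2N φ v Q) (i : Fin 2) (j : Fin (2 * N)) :
    vertexMatrix 2 Λ i v (Q j) = 1 := by
  obtain ⟨f, hf, huniq⟩ := hΛ.edge_center_outer _ (single_mem i) j
  refine Nat.card_eq_one_iff_unique.2 ⟨⟨fun x y => Subtype.ext ?_⟩, ⟨f, hf⟩⟩
  rw [huniq _ x.2, huniq _ y.2]

theorem vertexMatrix_outer_center (hΛ : IsLambda2N φ v Q) (i : Fin 2) (j : Fin (2 * N)) :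
    vertexMatrix 2 Λ i (Q j) v = 1 := by
  obtain ⟨f, hf, huniq⟩ := hΛ.edge_outer_center _ (single_mem i) j
  refine Nat.card_eq_one_iff_unique.2 ⟨⟨fun x y => Subtype.ext ?_⟩, ⟨f, hf⟩⟩
  rw [huniq _ x.2, huniq _ y.2]

theorem vertexMatrix_center_center (hΛ : IsLambda2N φ v Q) (i : Fin 2) :
    vertexMatrix 2 Λ i v v = 0 := by
  have : IsEmpty {f : v ⟶ v // KGraph.degree f = (Pi.single i 1 : Fin 2 → ℕ)} :=
    ⟨fun f => hΛ.no_edge_center_center _ (single_mem i) f.1 f.2⟩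
  exact Nat.card_of_isEmpty

theorem vertexMatrix_outer_outer (hΛ : IsLambda2N φ v Q) (i : Fin 2) (j l : Fin (2 * N)) :
    vertexMatrix 2 Λ i (Q j) (Q l) = 0 := by
  have : IsEmpty {f : Q j ⟶ Q l // KGraph.degree f = (Pi.single i 1 : Fin 2 → ℕ)} :=
    ⟨fun f => hΛ.no_edge_outer_outer _ (single_mem i) j l f.1 f.2⟩
  exact Nat.card_of_isEmpty

variable [Fintype Λ] [DecidableEq Λ]

theorem sum_vertices (hΛ : IsLambda2N φ v Q) {R : Type*} [AddCommMonoid R] (f : Λ → R) :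
    ∑ a, f a = f v + ∑ j, f (Q j) := by
  have : (Finset.univ : Finset Λ) = insert v (Finset.univ.image Q) := by
    ext a
    rcases hΛ.vertex_cases a with rfl | ⟨j, rfl⟩ <;> simp
  rw [this, Finset.sum_insert, Finset.sum_image fun _ _ _ _ h => hΛ.outer_injective h]
  simpa using hΛ.outer_ne_center

theorem mulVec_center (hΛ : IsLambda2N φ v Q) {R : Type*} [Semiring R] (i : Fin 2) (κ : Λ → R) :
    ((vertexMatrix 2 Λ i).map (fun n : ℕ => (n : R))).mulVec κ v = ∑ j, κ (Q j) := by
  rw [Matrix.mulVec, dotProduct, hΛ.sum_vertices]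
  simp [hΛ.vertexMatrix_center_center, hΛ.vertexMatrix_center_outer]

theorem mulVec_outer (hΛ : IsLambda2N φ v Q) {R : Type*} [Semiring R] (i : Fin 2) (κ : Λ → R)
    (j : Fin (2 * N)) :
    ((vertexMatrix 2 Λ i).map (fun n : ℕ => (n : R))).mulVec κ (Q j) = κ v := by
  rw [Matrix.mulVec, dotProduct, hΛ.sum_vertices]
  simp [hΛ.vertexMatrix_outer_center, hΛ.vertexMatrix_outer_outer]

/-- An eigenvector `x` for `z ≠ 0` satisfies `x v = z * x (Q j)`, so `x v ≠ 0`, and the equation at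
`v` gives `z ^ 2 = 2 * N`. The value `√(2 * N)` is attained by the vector that is `√(2 * N)` at the
center and `1` at the leaves. -/
theorem vertexRadius_eq (hΛ : IsLambda2N φ v Q) (hN : 1 ≤ N) (i : Fin 2) :
    vertexRadius 2 Λ i = √(2 * N) := by
  have hN' : (0 : ℝ) ≤ 2 * N := by positivity
  set A : Matrix Λ Λ ℂ := (vertexMatrix 2 Λ i).map (fun n : ℕ => (n : ℂ)) with hA
  suffices h : spectralRadius ℂ A = ENNReal.ofReal √(2 * N) by
    rw [vertexRadius, ← hA, h, ENNReal.toReal_ofReal (Real.sqrt_nonneg _)]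
  have hnorm : ∀ z : ℂ, (‖z‖₊ : ℝ≥0∞) = ENNReal.ofReal ‖z‖ := fun z =>
    (ofReal_norm z).symm
  refine le_antisymm (iSup₂_le fun z hz => ?_) ?_
  · rw [hnorm]
    refine ENNReal.ofReal_le_ofReal (Real.le_sqrt_of_sq_le ?_)
    obtain ⟨x, hx, hxz⟩ := (A.mem_spectrum_iff_exists_mulVec z).1 hz
    have h1 : ∑ j, x (Q j) = z * x v := by
      rw [← hΛ.mulVec_center i x, ← hA, hxz]; rfl
    have h2 : ∀ j, x v = z * x (Q j) := fun j => by
      rw [← hΛ.mulVec_outer i x j, ← hA, hxz]; rfl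
    by_cases hz0 : z = 0
    · simp [hz0]
    · have h3 : (2 * N : ℂ) * x v = z ^ 2 * x v := by
        have h4 : ∑ j, z * x (Q j) = z ^ 2 * x v := by rw [← Finset.mul_sum, h1, sq, mul_assoc]
        rw [← h4, Finset.sum_congr rfl fun j _ => (h2 j).symm]
        simp
      have hv : x v ≠ 0 := fun hv => hx <| funext fun a => by
        rcases hΛ.vertex_cases a with rfl | ⟨j, rfl⟩
        · exact hv
        · have := h2 j
          rw [hv] at this
          exact (mul_eq_zero.1 this.symm).resolve_left hz0
      have h4 := congrArg norm (mul_right_cancel₀ hv h3)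
      rw [norm_pow] at h4
      rw [← h4]
      simp
  · have hsq : ((√(2 * N) : ℝ) : ℂ) * (√(2 * N) : ℝ) = 2 * N := by
      rw [← Complex.ofReal_mul, Real.mul_self_sqrt hN']; simp
    have hmem : ((√(2 * N) : ℝ) : ℂ) ∈ spectrum ℂ A := by
      refine (A.mem_spectrum_iff_exists_mulVec _).2
        ⟨fun a => if a = v then ((√(2 * N) : ℝ) : ℂ) else 1, ?_, funext fun a => ?_⟩
      · intro h0
        have := congrFun h0 (Q ⟨0, by omega⟩)
        simp [hΛ.outer_ne_center] at this
      · rcases hΛ.vertex_cases a with rfl | ⟨j, rfl⟩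
        · rw [hΛ.mulVec_center]
          simp only [hΛ.outer_ne_center, if_true, if_false, Finset.sum_const, Finset.card_univ,
            Fintype.card_fin, Pi.smul_apply, smul_eq_mul, hsq]
          simp
        · rw [hΛ.mulVec_outer]
          simp [hΛ.outer_ne_center]
    refine le_trans ?_ (le_iSup₂_of_le _ hmem le_rfl)
    rw [hnorm, Complex.norm_real, Real.norm_of_nonneg (Real.sqrt_nonneg _)]

/-- The eigenvalue equations express every entry through one outer entry, which the normalization
fixes. Only outer entries are needed, since coding cylinders belong to paths whose source is an
outer vertex. -/
theorem perronFrobeniusVector_eq (hΛ : IsLambda2N φ v Q) (hN : 1 ≤ N) {κ : Λ → ℝ}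
    (hκ : IsPerronFrobeniusVector 2 κ) (j : Fin (2 * N)) :
    κ (Q j) = ((1 + √(2 * N)) * √(2 * N))⁻¹ := by
  have hN' : (0 : ℝ) < 2 * N := by positivity
  have hr : 0 < √(2 * N : ℝ) := Real.sqrt_pos.2 hN'
  have hrr : √(2 * N : ℝ) * √(2 * N) = 2 * N := Real.mul_self_sqrt hN'.le
  have h1 : ∀ j, κ v = √(2 * N) * κ (Q j) := fun j => by
    rw [← hΛ.mulVec_outer 0 κ j, hκ.eigen 0, hΛ.vertexRadius_eq hN]; rfl
  have h2 : ∑ j, κ (Q j) = √(2 * N) * κ v := by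
    rw [← hΛ.mulVec_center 0 κ, hκ.eigen 0, hΛ.vertexRadius_eq hN]; rfl
  have h3 := hκ.sum_eq_one
  rw [hΛ.sum_vertices, h2, h1 j] at h3
  refine eq_inv_of_mul_eq_one_left ?_
  linarith

theorem exists_perronFrobeniusVector (hΛ : IsLambda2N φ v Q) (hN : 1 ≤ N) :
    ∃ κ : Λ → ℝ, IsPerronFrobeniusVector 2 κ ∧ κ v = (1 + √(2 * N))⁻¹ ∧
      ∀ j, κ (Q j) = ((1 + √(2 * N)) * √(2 * N))⁻¹ := by
  have hN' : (0 : ℝ) < 2 * N := by positivity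
  have hr : 0 < √(2 * N : ℝ) := Real.sqrt_pos.2 hN'
  have hrr : √(2 * N : ℝ) * √(2 * N) = 2 * N := Real.mul_self_sqrt hN'.le
  let κ : Λ → ℝ := fun a => if a = v then (1 + √(2 * N))⁻¹ else ((1 + √(2 * N)) * √(2 * N))⁻¹
  have hv : κ v = (1 + √(2 * N))⁻¹ := if_pos rfl
  have hQ : ∀ j, κ (Q j) = ((1 + √(2 * N)) * √(2 * N))⁻¹ := fun j => if_neg (hΛ.outer_ne_center j)
  have hsum : ∑ j, κ (Q j) = √(2 * N) * κ v := by
    simp only [hQ, hv, Finset.sum_const, Finset.card_univ, Fintype.card_fin, nsmul_eq_mul]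
    push_cast
    rw [mul_inv, mul_comm (1 + _)⁻¹, ← mul_assoc]
    congr 1
    rw [mul_inv_eq_iff_eq_mul₀ hr.ne', hrr]
  refine ⟨κ, ⟨fun a => ?_, ?_, fun i => funext fun a => ?_⟩, hv, hQ⟩
  · rcases hΛ.vertex_cases a with rfl | ⟨j, rfl⟩
    · rw [hv]; positivity
    · rw [hQ]; positivity
  · rw [hΛ.sum_vertices, hsum, hv]
    field_simp
  · rw [hΛ.vertexRadius_eq hN]
    rcases hΛ.vertex_cases a with rfl | ⟨j, rfl⟩
    · rw [hΛ.mulVec_center, hsum]; rfl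
    · rw [hΛ.mulVec_outer, Pi.smul_apply, hQ, hv, smul_eq_mul]
      field_simp

/-- The Perron–Frobenius measure restricts to multiples of the uniform Markov measure. -/
theorem perronFrobenius_isWeightedMarkov (hΛ : IsLambda2N φ v Q) (hN : 1 ≤ N)
    {M : Measure (InfinitePath 2 Λ)} (hM : IsPerronFrobeniusMeasure 2 M) :
    IsWeightedMarkovMeasure v Q (fun _ _ => (2 * N : ℝ)⁻¹)
      (ENNReal.ofReal ((√(2 * N))⁻¹ * ((1 + √(2 * N)) * √(2 * N))⁻¹))
      (ENNReal.ofReal ((1 + √(2 * N)) * √(2 * N))⁻¹) M := by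
  obtain ⟨κ, hκ, hM⟩ := hM
  have hN' : (0 : ℝ) < 2 * N := by positivity
  have hr : 0 < √(2 * N : ℝ) := Real.sqrt_pos.2 hN'
  have hrr : √(2 * N : ℝ) * √(2 * N) = 2 * N := Real.mul_self_sqrt hN'.le
  constructor
  · intro n a
    obtain ⟨η, h1, h2, h3⟩ := hΛ.centerCylinder_eq a
    rw [h3, hM, h2, hΛ.perronFrobeniusVector_eq hN hκ, ← ENNReal.ofReal_mul (by positivity)]
    congr 1
    -- There are `n + 1` red and `n` blue edges. The pairs contribute `(2 * N)⁻¹ ^ n`, and the extra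
    -- red edge is the factor `(√(2 * N))⁻¹` in the weight of the first copy.
    simp only [hΛ.vertexRadius_eq hN, h1, Fin.prod_univ_two, red, blue, Finset.prod_const,
      Finset.card_univ, Fintype.card_fin]
    simp only [Pi.add_apply, Pi.smul_apply, Pi.single_eq_same, smul_eq_mul, ne_eq,
      Fin.zero_ne_one, one_ne_zero, not_false_eq_true, Pi.single_eq_of_ne, mul_one, zero_add,
      add_zero, Fin.isValue]
    generalize √(2 * N : ℝ) = r at hr hrr ⊢
    rw [← hrr, inv_pow, mul_pow, pow_succ]
    field_simp
  · intro n a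
    obtain ⟨η, h1, h2, h3⟩ := hΛ.outerCylinder_eq a
    rw [h3, hM, h2, hΛ.perronFrobeniusVector_eq hN hκ, ← ENNReal.ofReal_mul (by positivity)]
    congr 1
    simp only [hΛ.vertexRadius_eq hN, h1, Fin.prod_univ_two, red, blue, Finset.prod_const,
      Finset.card_univ, Fintype.card_fin]
    simp only [Pi.add_apply, Pi.smul_apply, Pi.single_eq_same, smul_eq_mul, ne_eq,
      Fin.zero_ne_one, one_ne_zero, not_false_eq_true, Pi.single_eq_of_ne, mul_one, zero_add,
      add_zero, Fin.isValue]
    generalize √(2 * N : ℝ) = r at hr hrr ⊢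
    rw [← hrr, inv_pow, mul_pow, mul_comm]

/-- The weighted uniform Markov measure has mass `κ a` on the paths with range `a`, and every edge
scales it by `(√(2 * N))⁻¹`. The formula thus holds for all finite paths, not only for those behind
coding cylinders. -/
theorem existsUnique_perronFrobeniusMeasure (hΛ : IsLambda2N φ v Q) (hN : 1 ≤ N) :
    ∃! M : Measure (InfinitePath 2 Λ), IsPerronFrobeniusMeasure 2 M := by
  have hN' : (0 : ℝ) < 2 * N := by positivity
  have hr : 0 < √(2 * N : ℝ) := Real.sqrt_pos.2 hN'
  have hrr : √(2 * N : ℝ) * √(2 * N) = 2 * N := Real.mul_self_sqrt hN'.le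
  refine existsUnique_of_exists_of_unique ?_ fun M M' h h' =>
    hΛ.weightedMarkov_unique (hΛ.perronFrobenius_isWeightedMarkov hN h)
      (hΛ.perronFrobenius_isWeightedMarkov hN h') ENNReal.ofReal_ne_top ENNReal.ofReal_ne_top
  obtain ⟨κ, hκ, hκv, hκQ⟩ := hΛ.exists_perronFrobeniusVector hN
  set q : ℝ := ((1 + √(2 * N)) * √(2 * N))⁻¹ with hq
  have hq0 : 0 < q := by positivity
  obtain ⟨M, hM⟩ := hΛ.exists_weightedMarkov (T := fun _ _ => (2 * N : ℝ)⁻¹)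
    (fun _ _ => by positivity) (fun _ => by simp; field_simp)
    (ENNReal.ofReal ((√(2 * N))⁻¹ * q)) (ENNReal.ofReal q)
  refine ⟨M, κ, hκ, fun η => ?_⟩
  have hsrc : M (cylinder 2 (FinPath.ofVertex η.s)) = ENNReal.ofReal (κ η.s) := by
    rcases hΛ.vertex_cases η.s with h | ⟨j, h⟩ <;> rw [h]
    · rw [← Set.inter_univ (cylinder 2 _), hΛ.measure_center_inter _ MeasurableSet.univ, hκv]
      simp only [Set.inter_univ, hM.center]
      simp only [Finset.univ_eq_empty, Finset.prod_empty, ENNReal.ofReal_one, mul_one,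
        Finset.sum_const, Finset.card_univ, Fintype.card_fin]
      rw [← ENNReal.ofReal_nsmul, hq, nsmul_eq_mul]
      push_cast
      generalize √(2 * N : ℝ) = r at hr hrr ⊢
      rw [← hrr]
      congr 1
      field_simp
    · rw [← outerCylinder_one, hM.outer, hκQ]
      simp
  have := measure_cylinder_of_edges (μ := M) (r := ENNReal.ofReal (√(2 * N))⁻¹)
    (fun e i he E hE => hΛ.uniform_prefix (by positivity) hM ENNReal.ofReal_ne_top
      ENNReal.ofReal_ne_top (by simpa using hr) ENNReal.ofReal_ne_top (by simpa using hq0)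
      (ENNReal.ofReal_mul (by positivity))
      (by rw [← ENNReal.ofReal_mul (by positivity), ← mul_inv, hrr]) e i he E hE) η
  rw [this, hsrc, ← ENNReal.ofReal_pow (by positivity), ← ENNReal.ofReal_mul (by positivity)]
  simp only [hΛ.vertexRadius_eq hN]
  rw [Finset.prod_pow_eq_pow_sum, inv_pow]

end IsLambda2N

/-! ## Mutual singularity -/

/-! ### Path sums, contraction and geometric means -/

section Matrix

variable {ι : Type*} [Fintype ι]

/-- Induction on the length, splitting off the first letter. The weight `g` serves the induction,
where it becomes a row of `S`. -/
theorem sum_path_prod [DecidableEq ι] (S : Matrix ι ι ℝ) (n : ℕ) (g : ι → ℝ) :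
    ∑ a : Fin (n + 1) → ι, g (a 0) * ∏ t : Fin n, S (a t.castSucc) (a t.succ) =
      ∑ i, g i * ((S ^ n).mulVec 1) i := by
  induction n generalizing g with
  | zero =>
    rw [← (Equiv.funUnique (Fin 1) ι).symm.sum_comp]
    simp
  | succ n ih =>
    rw [← (Fin.consEquiv fun _ => ι).sum_comp, Fintype.sum_prod_type]
    refine Finset.sum_congr rfl fun i _ => ?_
    have := ih (S i)
    rw [pow_succ', ← Matrix.mulVec_mulVec, Matrix.mulVec, dotProduct, ← this, Finset.mul_sum]
    refine Finset.sum_congr rfl fun a _ => ?_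
    rw [Fin.prod_univ_succ]
    rfl

theorem pow_mulVec_one_le [DecidableEq ι] {B : Matrix ι ι ℝ} (hB : ∀ i j, 0 ≤ B i j) {θ : ℝ}
    (hθ0 : 0 ≤ θ) (hθ : ∀ i, B.mulVec 1 i ≤ θ) (k : ℕ) (i : ι) : ((B ^ k).mulVec 1) i ≤ θ ^ k := by
  induction k generalizing i with
  | zero => simp
  | succ k ih =>
    rw [pow_succ', ← Matrix.mulVec_mulVec, pow_succ]
    calc B.mulVec ((B ^ k).mulVec 1) i ≤ ∑ j, B i j * θ ^ k :=
          Finset.sum_le_sum fun j _ => mul_le_mul_of_nonneg_left (ih j) (hB i j)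
      _ = θ ^ k * B.mulVec 1 i := by
          rw [← Finset.sum_mul, mul_comm]
          simp [Matrix.mulVec, dotProduct]
      _ ≤ θ ^ k * θ := mul_le_mul_of_nonneg_left (hθ i) (pow_nonneg hθ0 k)

/-- A positive matrix with row sums at most one, not all equal to one, has a square that strictly
contracts. -/
theorem exists_sq_mulVec_one_le [DecidableEq ι] {S : Matrix ι ι ℝ} (hS : ∀ i j, 0 < S i j)
    (hle : ∀ i, ∑ j, S i j ≤ 1) {c : ι} (hc : ∑ j, S c j < 1) :
    ∃ θ : ℝ, 0 ≤ θ ∧ θ < 1 ∧ ∀ i, (S ^ 2).mulVec 1 i ≤ θ := by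
  have hsum : ∀ i, (S ^ 2).mulVec 1 i = ∑ j, S i j * ∑ l, S j l := fun i => by
    rw [sq, ← Matrix.mulVec_mulVec]
    simp [Matrix.mulVec, dotProduct]
  have : Nonempty ι := ⟨c⟩
  obtain ⟨i, hi⟩ := Finite.exists_max ((S ^ 2).mulVec 1)
  refine ⟨_, ?_, ?_, hi⟩
  · rw [hsum]
    exact Finset.sum_nonneg fun j _ =>
      mul_nonneg (hS i j).le (Finset.sum_nonneg fun l _ => (hS j l).le)
  · rw [hsum]
    -- As `S i c > 0`, every row reaches the deficient row `c` in one step and loses mass there.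
    refine lt_of_lt_of_le (Finset.sum_lt_sum (g := fun j => S i j) (fun j _ => ?_)
      ⟨c, Finset.mem_univ c, ?_⟩) (hle i)
    · exact mul_le_of_le_one_right (hS i j).le (hle j)
    · exact mul_lt_of_lt_one_right (hS i c) hc

theorem sqrt_mul_le_half_add {a b : ℝ} (ha : 0 ≤ a) (hb : 0 ≤ b) : √(a * b) ≤ (a + b) / 2 := by
  rw [Real.sqrt_le_left (by positivity)]
  nlinarith [sq_nonneg (a - b)]

theorem sqrt_mul_lt_half_add {a b : ℝ} (ha : 0 ≤ a) (hb : 0 ≤ b) (hab : a ≠ b) :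
    √(a * b) < (a + b) / 2 := by
  have : 0 < (a - b) ^ 2 := by
    have := sub_ne_zero.2 hab
    positivity
  refine (Real.sqrt_lt_sqrt (y := ((a + b) / 2) ^ 2) (by positivity) (by nlinarith)).trans_eq ?_
  exact Real.sqrt_sq (by positivity)

end Matrix

/-- Since `min p q ^ 2 ≤ p * q`, the part of a cylinder mass common to two Markov measures is
bounded by a path product of their affinity matrix. -/
theorem min_le_sqrt_mul_prod {ι : Type*} (s : Finset ι) {f g : ι → ℝ} (hf : ∀ i, 0 ≤ f i)
    (hg : ∀ i, 0 ≤ g i) {A : ℝ} (hA : 0 ≤ A) :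
    min (∏ i ∈ s, f i) (A * ∏ i ∈ s, g i) ≤ √A * ∏ i ∈ s, √(f i * g i) := by
  have hp : 0 ≤ ∏ i ∈ s, f i := Finset.prod_nonneg fun i _ => hf i
  have hq : 0 ≤ A * ∏ i ∈ s, g i := mul_nonneg hA (Finset.prod_nonneg fun i _ => hg i)
  have hR : 0 ≤ √A * ∏ i ∈ s, √(f i * g i) :=
    mul_nonneg (Real.sqrt_nonneg _) (Finset.prod_nonneg fun i _ => Real.sqrt_nonneg _)
  refine (pow_le_pow_iff_left₀ (le_min hp hq) hR two_ne_zero).1 ?_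
  calc min (∏ i ∈ s, f i) (A * ∏ i ∈ s, g i) ^ 2
      ≤ (∏ i ∈ s, f i) * (A * ∏ i ∈ s, g i) := by
        rw [sq]
        exact mul_le_mul (min_le_left _ _) (min_le_right _ _) (le_min hp hq) hp
    _ = (√A * ∏ i ∈ s, √(f i * g i)) ^ 2 := by
        rw [mul_pow, Real.sq_sqrt hA, ← Finset.prod_pow,
          Finset.prod_congr rfl fun i _ => Real.sq_sqrt (mul_nonneg (hf i) (hg i)),
          Finset.prod_mul_distrib]
        ring

namespace IsLambda2N

variable {N : ℕ} {φ : Equiv.Perm (Fin (2 * N))} {Λ : Type u} [Category.{w} Λ] [KGraph 2 Λ]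
  {v : Λ} {Q : Fin (2 * N) → Λ} {T U : Matrix (Fin (2 * N)) (Fin (2 * N)) ℝ}
  {μ M : Measure (InfinitePath 2 Λ)}

/-- Weighted Markov measures whose transition matrices have a Hellinger affinity with a strictly
contracting square are mutually singular. -/
theorem mutuallySingular_of_affinity (hΛ : IsLambda2N φ v Q) {A B θ : ℝ} (hA : 0 ≤ A)
    (hB : 0 ≤ B) (hT : ∀ i j, 0 ≤ T i j) (hU : ∀ i j, 0 ≤ U i j)
    (hμ : IsWeightedMarkovMeasure v Q T 1 1 μ)
    (hM : IsWeightedMarkovMeasure v Q U (ENNReal.ofReal A) (ENNReal.ofReal B) M)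
    (hθ0 : 0 ≤ θ) (hθ1 : θ < 1)
    (hθ : ∀ i, ((Matrix.of fun i j => √(T i j * U i j)) ^ 2).mulVec 1 i ≤ θ) : μ ⟂ₘ M := by
  set S : Matrix (Fin (2 * N)) (Fin (2 * N)) ℝ := Matrix.of fun i j => √(T i j * U i j) with hS
  have hS0 : ∀ i j, 0 ≤ S i j := fun i j => Real.sqrt_nonneg _
  have hSS : ∀ i j, 0 ≤ (S ^ 2) i j := fun i j => by
    rw [sq, Matrix.mul_apply]
    exact Finset.sum_nonneg fun l _ => mul_nonneg (hS0 _ _) (hS0 _ _)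
  -- Disjointness in the lattice of measures: every `ξ` below both `μ` and `M` must vanish.
  rw [Measure.mutuallySingular_iff_disjoint]
  intro ξ h1 h2
  -- Words with `2 * k` transitions are used because only `S ^ 2` is known to contract. The two
  -- copies contribute `√A` and `√B`, and there are `2 * N` first letters.
  have hbound : ∀ k : ℕ, ξ Set.univ ≤ ENNReal.ofReal ((√A + √B) * (2 * N) * θ ^ k) := by
    intro k
    have hprod : ∀ a : Fin (2 * k + 1) → Fin (2 * N),
        0 ≤ ∏ t : Fin (2 * k), S (a t.castSucc) (a t.succ) := fun a =>
      Finset.prod_nonneg fun t _ => hS0 _ _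
    have hc : ∀ a : Fin (2 * k + 1) → Fin (2 * N), ξ (centerCylinder v Q a) ≤
        ENNReal.ofReal (√A * ∏ t : Fin (2 * k), S (a t.castSucc) (a t.succ)) := fun a => by
      refine le_trans ?_ (ENNReal.ofReal_le_ofReal (min_le_sqrt_mul_prod Finset.univ
        (fun t => hT _ _) (fun t => hU _ _) hA))
      rw [ENNReal.ofReal_min, ENNReal.ofReal_mul hA, ← hM.center,
        ← one_mul (ENNReal.ofReal (∏ t, T _ _)), ← hμ.center]
      exact le_min (h1 _) (h2 _)
    have ho : ∀ a : Fin (2 * k + 1) → Fin (2 * N), ξ (outerCylinder Q a) ≤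
        ENNReal.ofReal (√B * ∏ t : Fin (2 * k), S (a t.castSucc) (a t.succ)) := fun a => by
      refine le_trans ?_ (ENNReal.ofReal_le_ofReal (min_le_sqrt_mul_prod Finset.univ
        (fun t => hT _ _) (fun t => hU _ _) hB))
      rw [ENNReal.ofReal_min, ENNReal.ofReal_mul hB, ← hM.outer,
        ← one_mul (ENNReal.ofReal (∏ t, T _ _)), ← hμ.outer]
      exact le_min (h1 _) (h2 _)
    have hpath := sum_path_prod S (2 * k) 1
    simp only [Pi.one_apply, one_mul] at hpath
    calc ξ Set.univ ≤ ∑ a : Fin (2 * k + 1) → Fin (2 * N), ξ (centerCylinder v Q a) +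
          ∑ a : Fin (2 * k + 1) → Fin (2 * N), ξ (outerCylinder Q a) := by
          rw [← hΛ.iUnion_cylinders (2 * k)]
          exact (measure_union_le _ _).trans
            (add_le_add (measure_iUnion_fintype_le _ _) (measure_iUnion_fintype_le _ _))
      _ ≤ _ := add_le_add (Finset.sum_le_sum fun a _ => hc a) (Finset.sum_le_sum fun a _ => ho a)
      _ = ENNReal.ofReal ((√A + √B) * ∑ i, ((S ^ (2 * k)).mulVec 1) i) := by
          rw [← ENNReal.ofReal_sum_of_nonneg fun a _ => mul_nonneg (Real.sqrt_nonneg _) (hprod a),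
            ← ENNReal.ofReal_sum_of_nonneg fun a _ => mul_nonneg (Real.sqrt_nonneg _) (hprod a),
            ← Finset.mul_sum, ← Finset.mul_sum, ← ENNReal.ofReal_add, hpath, add_mul]
          · exact mul_nonneg (Real.sqrt_nonneg _) (Finset.sum_nonneg fun a _ => hprod a)
          · exact mul_nonneg (Real.sqrt_nonneg _) (Finset.sum_nonneg fun a _ => hprod a)
      _ ≤ ENNReal.ofReal ((√A + √B) * (2 * N) * θ ^ k) := by
          refine ENNReal.ofReal_le_ofReal ?_
          rw [mul_assoc]
          refine mul_le_mul_of_nonneg_left ?_ (by positivity)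
          refine (Finset.sum_le_sum fun i _ => ?_).trans_eq (b := ∑ i : Fin (2 * N), θ ^ k) ?_
          · rw [pow_mul]
            exact pow_mulVec_one_le hSS hθ0 hθ k i
          · simp
  have hlim : Filter.Tendsto (fun k : ℕ => ENNReal.ofReal ((√A + √B) * (2 * N) * θ ^ k))
      Filter.atTop (nhds 0) := by
    have := ((tendsto_pow_atTop_nhds_zero_of_lt_one hθ0 hθ1).const_mul
      ((√A + √B) * (2 * N : ℝ)))
    rw [mul_zero] at this
    simpa using ENNReal.tendsto_ofReal this
  have h0 : ξ Set.univ = 0 := le_antisymm (ge_of_tendsto' hlim hbound) zero_le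
  rw [Measure.measure_univ_eq_zero.1 h0]
  exact bot_le

/-- A Markov measure with a row different from the uniform distribution is singular to the
Perron–Frobenius measure. -/
theorem mutuallySingular_perronFrobenius [Fintype Λ] [DecidableEq Λ] (hΛ : IsLambda2N φ v Q)
    (hN : 1 ≤ N) (hT : ∀ i j, 0 < T i j) (hsum : ∀ i, ∑ j, T i j = 1)
    (hne : ∃ i j, T i j ≠ (2 * N : ℝ)⁻¹) (hμ : IsWeightedMarkovMeasure v Q T 1 1 μ)
    (hM : IsPerronFrobeniusMeasure 2 M) : μ ⟂ₘ M := by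
  have hu : (0 : ℝ) < (2 * N : ℝ)⁻¹ := by positivity
  -- By AM-GM the average of a row of `T` and the uniform row dominates the affinity row, strictly
  -- at an entry where the two differ.
  have hhalf : ∀ i, ∑ j, (T i j + (2 * N : ℝ)⁻¹) / 2 = 1 := fun i => by
    rw [← Finset.sum_div, Finset.sum_add_distrib, hsum]
    simp
    field_simp
    norm_num
  obtain ⟨c, l, hcl⟩ := hne
  obtain ⟨θ, h0, h1, hθ⟩ := exists_sq_mulVec_one_le
    (S := Matrix.of fun i j => √(T i j * (2 * N : ℝ)⁻¹)) (c := c)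
    (fun i j => Real.sqrt_pos.2 (mul_pos (hT i j) hu))
    (fun i => (Finset.sum_le_sum fun j _ =>
      sqrt_mul_le_half_add (hT i j).le hu.le).trans_eq (hhalf i))
    ((Finset.sum_lt_sum (fun j _ => sqrt_mul_le_half_add (hT c j).le hu.le)
      ⟨l, Finset.mem_univ l, sqrt_mul_lt_half_add (hT c l).le hu.le hcl⟩).trans_eq (hhalf c))
  exact hΛ.mutuallySingular_of_affinity (by positivity) (by positivity)
    (fun i j => (hT i j).le) (fun _ _ => hu.le) hμ
    (hΛ.perronFrobenius_isWeightedMarkov hN hM) h0 h1 hθ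

theorem markov_vertex_pos (hΛ : IsLambda2N φ v Q) (hN : 1 ≤ N)
    (hμ : IsWeightedMarkovMeasure v Q T 1 1 μ) (a : Λ) :
    0 < μ (cylinder 2 (FinPath.ofVertex a)) := by
  rcases hΛ.vertex_cases a with rfl | ⟨j, rfl⟩
  · rw [← hΛ.iUnion_centerCylinder]
    refine lt_of_lt_of_le ?_ (measure_mono (Set.subset_iUnion _ ⟨0, by omega⟩))
    simp [hμ.center]
  · simp [← outerCylinder_one, hμ.outer]

end IsLambda2N

/-! ## The matrices `T_x` -/

section CycleMatrix

variable {n : ℕ} {φ : Equiv.Perm (Fin n)} {x : CycleMin φ → Fin n → ℝ}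

theorem cycleMatrix_pos (hx : ∀ c i, 0 < x c i) (i j : Fin n) : 0 < cycleMatrix φ x i j :=
  hx _ _

theorem cycleMatrix_row_sum (hx : ∀ c, ∑ i, x c i = 1) (i : Fin n) :
    ∑ j, cycleMatrix φ x i j = 1 := by
  classical
  rw [← hx (exists_cycleMin φ i).choose]
  exact Equiv.sum_comp (φ ^ Nat.find (exists_cycleMin φ i).choose_spec)⁻¹
    (x (exists_cycleMin φ i).choose)

/-- Two smallest entries of the same cycle coincide, so the representative chosen for `c` is `c`
itself. -/
theorem cycleMin_choose (c : CycleMin φ) : (exists_cycleMin φ c.1).choose = c := by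
  obtain ⟨t, ht⟩ := (exists_cycleMin φ c.1).choose_spec
  set c' := (exists_cycleMin φ c.1).choose
  have h : φ.SameCycle c'.1 c.1 := ⟨t, by simpa using ht⟩
  exact Subtype.ext (le_antisymm (c'.2 _ h) (c.2 _ h.symm))

/-- Row `c` of `T_x` is `x c` rearranged by a power of `φ`, so it is constant only if `x c` is. -/
theorem exists_cycleMatrix_eq (c : CycleMin φ) (i : Fin n) :
    ∃ j, cycleMatrix φ x c.1 j = x c i := by
  classical
  refine ⟨(φ ^ Nat.find (exists_cycleMin φ c.1).choose_spec) i, ?_⟩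
  change x (exists_cycleMin φ c.1).choose _ = _
  exact (congrFun (congrArg x (cycleMin_choose c)) _).trans
    (congrArg (x c) (Equiv.symm_apply_apply _ _))

end CycleMatrix

theorem mainTheorem7 {Λ : Type u} [Category.{w} Λ] [KGraph 2 Λ] [Fintype Λ] [DecidableEq Λ]
    {N : ℕ} (hN : 1 ≤ N) (φ : Equiv.Perm (Fin (2 * N)))
    (v : Λ) (Q : Fin (2 * N) → Λ) (hΛ : IsLambda2N φ v Q)
    (x : CycleMin φ → Fin (2 * N) → ℝ)
    (hx_pos : ∀ c i, 0 < x c i) (hx_lt : ∀ c i, x c i < 1) (hx_sum : ∀ c, ∑ i, x c i = 1)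
    (hT : ∀ i j, cycleMatrix φ x (φ i) (φ j) = cycleMatrix φ x i j) :
    (∃! μ : Measure (InfinitePath 2 Λ), IsMarkovMeasure v Q (cycleMatrix φ x) μ) ∧
    (∃! M : Measure (InfinitePath 2 Λ), IsPerronFrobeniusMeasure 2 M) ∧
    ∀ μ : Measure (InfinitePath 2 Λ), IsMarkovMeasure v Q (cycleMatrix φ x) μ →
      StandardMapsSemibranching 2 μ ∧
      ((∃ c i j, x c i ≠ x c j) →
        ∀ M : Measure (InfinitePath 2 Λ), IsPerronFrobeniusMeasure 2 M → μ ⟂ₘ M) := by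
  have hpos := cycleMatrix_pos (φ := φ) hx_pos
  have hsum := cycleMatrix_row_sum (φ := φ) hx_sum
  refine ⟨existsUnique_of_exists_of_unique ?_ fun μ ν h h' => ?_,
    hΛ.existsUnique_perronFrobeniusMeasure hN, fun μ hμ => ?_⟩
  · obtain ⟨μ, hμ⟩ := hΛ.exists_weightedMarkov (fun i j => (hpos i j).le) hsum 1 1
    exact ⟨μ, fun n a => by rw [hμ.center, one_mul], fun n a => by rw [hμ.outer, one_mul]⟩
  · exact hΛ.weightedMarkov_unique h.isWeightedMarkovMeasure h'.isWeightedMarkovMeasure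
      ENNReal.one_ne_top ENNReal.one_ne_top
  · have hw := hμ.isWeightedMarkovMeasure
    have hfin := hΛ.weightedMarkov_isFiniteMeasure hw ENNReal.one_ne_top ENNReal.one_ne_top
    refine ⟨standardMapsSemibranching_of_quasiInvariant μ (hΛ.markov_vertex_pos hN hw)
      (hΛ.markov_quasiInvariant hpos hT hw), ?_⟩
    rintro ⟨c, i, j, hij⟩ M hM
    refine hΛ.mutuallySingular_perronFrobenius hN hpos hsum ⟨c.1, ?_⟩ hw hM
    -- If row `c` were uniform, both `x c i` and `x c j` would equal `(2 * N)⁻¹`.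
    by_contra! h
    obtain ⟨i', hi⟩ := exists_cycleMatrix_eq (x := x) c i
    obtain ⟨j', hj⟩ := exists_cycleMatrix_eq (x := x) c j
    exact hij (by rw [← hi, ← hj, h, h])
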